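/- Let $\ell:\mathbb{R}^{d_\theta}\times\mathbb{R}^{d_x}\to\mathbb{R}$ be differentiable (for instance $\ell(\theta,x)=\log p_\theta(y,x)$ for a latent variable model with fixed data $y$), and suppose that, for some $K>0$, $$\|\nabla_{(\theta,x)}\ell(\theta,x)-\nabla_{(\theta,x)}\ell(\theta',x')\|\le K\,\|(\theta,x)-(\theta',x')\|\qquad\text{for all }(\theta,x),(\theta',x')\in\mathbb{R}^{d_\theta}\times\mathbb{R}^{d_x}.$$ Let $\eta_\theta,\eta_x>0$ and $\gamma_\theta,\gamma_x\ge 0$. Let $\theta_0,m_0\in\mathbb{R}^{d_\theta}$, and let $q_0$ be a Borel probability measure on $\mathbb{R}^{d_x}\times\mathbb{R}^{d_x}$ with finite second moment. Let $(\Omega,\mathcal{A},(\mathcal{F}_t)_{t\ge0},P)$ be a filtered probability space carrying a standard $d_x$-dimensional Wiener process $W$ relative to $(\mathcal{F}_t)$ and an $\mathcal{F}_0$-measurable random vector $(X_0,U_0)$ with law $q_0$. Consider the McKean--Vlasov SDE $$\begin{aligned} \mathrm{d}\theta_t&=\eta_\theta m_t\,\mathrm{d}t,\\ \mathrm{d}m_t&=\Big[\int\nabla_\theta\ell(\theta_t,x)\,\mathrm{Law}(X_t)(\mathrm{d}x)-\gamma_\theta\eta_\theta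 m_t\Big]\mathrm{d}t,\\ \mathrm{d}X_t&=\eta_x U_t\,\mathrm{d}t,\\ \mathrm{d}U_t&=\big[\nabla_x\ell(\theta_t,X_t)-\gamma_x\eta_x U_t\big]\mathrm{d}t+\sqrt{2\gamma_x}\,\mathrm{d}W_t, \end{aligned}$$ with initial value $(\theta_0,m_0,X_0,U_0)$. By a solution on a time interval we mean continuous processes, adapted to the $P$-completed filtration, for which almost surely $\nabla_\theta\ell(\theta_t,\cdot)$ is $\mathrm{Law}(X_t)$-integrable for every $t$, the function $t\mapsto\int\nabla_\theta\ell(\theta_t,x)\,\mathrm{Law}(X_t)(\mathrm{d}x)$ is locally integrable in time, and the integrated form of the four equations holds for all $t$. Then on $[0,\infty)$, and on every interval $[0,T]$ with $0\le T<\infty$, there is a solution $(\theta,m,X,U)$ that is a strong one, that is, $X$ and $U$ are adapted to the $P$-completion of the filtration $\sigma((X_0,U_0),W_s:s\le t)$; in it, $\theta$ and $m$ are deterministic curves in $\mathbb{R}^{d_\theta}$, and $\mathrm{Law}(X_t,U_t)$ has finite second moment for every $t$. The solution is unique: every solution on the same interval adapted to the $P$-completion of $(\mathcal{F}_t)$ (with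 $\theta$ and $m$ allowed to be random) is indistinguishable from it. -/

import Mathlib

open MeasureTheory ProbabilityTheory
open scoped NNReal ENNReal

noncomputable section

namespace MomentumFlow

/-- `ℝ^d` with its Euclidean structure. -/
abbrev Vec (d : ℕ) : Type := EuclideanSpace ℝ (Fin d)

/-- The potential `ℓ` as a function of the pair `(θ, x)`, on the Euclidean space
`ℝ^{dθ} × ℝ^{dx}` (with the Euclidean product norm). -/
def jointPotential {dθ dx : ℕ} (ℓ : Vec dθ → Vec dx → ℝ) : WithLp 2 (Vec dθ × Vec dx) → ℝ :=
  fun z => ℓ z.fst z.snd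

/-- `ℓ` is differentiable and `∇_{(θ,x)} ℓ` is `K`-Lipschitz for the Euclidean norms. -/
def HasLipschitzGradient {dθ dx : ℕ} (ℓ : Vec dθ → Vec dx → ℝ) (K : ℝ) : Prop :=
  Differentiable ℝ (jointPotential ℓ) ∧
    ∀ z z' : WithLp 2 (Vec dθ × Vec dx),
      ‖gradient (jointPotential ℓ) z - gradient (jointPotential ℓ) z'‖ ≤ K * ‖z - z'‖

/-- The partial gradient `∇_θ ℓ (θ, x)`. -/
def gradTheta {dθ dx : ℕ} (ℓ : Vec dθ → Vec dx → ℝ) (θ : Vec dθ) (x : Vec dx) : Vec dθ :=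
  gradient (fun θ' => ℓ θ' x) θ

/-- The partial gradient `∇_x ℓ (θ, x)`. -/
def gradX {dθ dx : ℕ} (ℓ : Vec dθ → Vec dx → ℝ) (θ : Vec dθ) (x : Vec dx) : Vec dx :=
  gradient (fun x' => ℓ θ x') x

/-- `q` is a probability measure on `ℝ^{dx} × ℝ^{dx}` with finite second moment. -/
def IsP2 {d : ℕ} (q : Measure (Vec d × Vec d)) : Prop :=
  IsProbabilityMeasure q ∧ ∫⁻ z, (‖z.1‖ₑ ^ 2 + ‖z.2‖ₑ ^ 2) ∂q < ∞

/-- `W` is a standard `d`-dimensional Wiener process relative to the filtration `𝓕`: it is adapted,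
starts at zero, has continuous paths, and for `s ≤ t` the increment `W t - W s` is independent
of `𝓕 s` and has law `N(0, (t - s) I)`. -/
structure IsWiener {Ω : Type*} {mΩ : MeasurableSpace Ω} {d : ℕ} (P : Measure Ω)
    (𝓕 : Filtration ℝ≥0 mΩ) (W : ℝ≥0 → Ω → Vec d) : Prop where
  adapted : ∀ t, Measurable[𝓕 t] (W t)
  zero : ∀ᵐ ω ∂P, W 0 ω = 0
  cont : ∀ᵐ ω ∂P, Continuous fun t => W t ω
  indep : ∀ s t, s ≤ t →
    Indep (MeasurableSpace.comap (fun ω => W t ω - W s ω) inferInstance) (𝓕 s) P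
  law : ∀ s t, s ≤ t →
    HasLaw (fun ω => W t ω - W s ω)
      (multivariateGaussian 0 (((t : ℝ) - (s : ℝ)) • (1 : Matrix (Fin d) (Fin d) ℝ))) P

/-- The σ-algebras `σ(ξ, W_s : s ≤ t)` generated by the initial value and the noise. -/
@[reducible]
def dataHistory {Ω : Type*} {d : ℕ} (ξ : Ω → Vec d × Vec d) (W : ℝ≥0 → Ω → Vec d) (t : ℝ≥0) :
    MeasurableSpace Ω :=
  MeasurableSpace.comap ξ inferInstance ⊔
    ⨆ s : Set.Iic t, MeasurableSpace.comap (W s) inferInstance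

/-- The finite times `t` with `0 ≤ t ≤ T`; for `T = ∞` this is `[0, ∞)`. -/
def times (T : ℝ≥0∞) : Set ℝ≥0 := {t | (t : ℝ≥0∞) ≤ T}

/-- `(θ, m, X, U)` solves, on the time interval `times T`, the McKean–Vlasov system

* `dθ_t = ηθ m_t dt`,
* `dm_t = [∫ ∇_θ ℓ(θ_t, x) Law(X_t)(dx) - γθ ηθ m_t] dt`,
* `dX_t = ηx U_t dt`,
* `dU_t = [∇_x ℓ(θ_t, X_t) - γx ηx U_t] dt + √(2 γx) dW_t`,

with initial values `(θ₀, m₀)` and `ξ = (X_0, U_0)`.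

The four components have continuous paths and are adapted to the `P`-completion of the σ-algebras
`𝓖 t` (a map is a.e. strongly measurable with respect to `𝓖 t` when it agrees `P`-almost surely with
a `𝓖 t`-measurable one). The two `integrable` fields say that the mean-field drift is well defined. -/
structure IsSolution {Ω : Type*} {mΩ : MeasurableSpace Ω} {dθ dx : ℕ} (P : Measure Ω)
    (ℓ : Vec dθ → Vec dx → ℝ) (ηθ γθ ηx γx : ℝ)
    (θ₀ m₀ : Vec dθ) (ξ : Ω → Vec dx × Vec dx) (W : ℝ≥0 → Ω → Vec dx)
    (T : ℝ≥0∞) (𝓖 : ℝ≥0 → MeasurableSpace Ω)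
    (θ m : ℝ≥0 → Ω → Vec dθ) (X U : ℝ≥0 → Ω → Vec dx) : Prop where
  adapted_θ : ∀ t ∈ times T, AEStronglyMeasurable[𝓖 t] (θ t) P
  adapted_m : ∀ t ∈ times T, AEStronglyMeasurable[𝓖 t] (m t) P
  adapted_X : ∀ t ∈ times T, AEStronglyMeasurable[𝓖 t] (X t) P
  adapted_U : ∀ t ∈ times T, AEStronglyMeasurable[𝓖 t] (U t) P
  cont_θ : ∀ᵐ ω ∂P, ContinuousOn (fun t => θ t ω) (times T)
  cont_m : ∀ᵐ ω ∂P, ContinuousOn (fun t => m t ω) (times T)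
  cont_X : ∀ᵐ ω ∂P, ContinuousOn (fun t => X t ω) (times T)
  cont_U : ∀ᵐ ω ∂P, ContinuousOn (fun t => U t ω) (times T)
  integrable_space : ∀ᵐ ω ∂P, ∀ t ∈ times T,
    Integrable (fun x => gradTheta ℓ (θ t ω) x) (P.map (X t))
  integrable_time : ∀ᵐ ω ∂P, ∀ t ∈ times T,
    IntervalIntegrable
      (fun s : ℝ => ∫ x, gradTheta ℓ (θ s.toNNReal ω) x ∂(P.map (X s.toNNReal))) volume 0 t
  eq_θ : ∀ᵐ ω ∂P, ∀ t ∈ times T,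
    θ t ω = θ₀ + ∫ s in (0 : ℝ)..t, ηθ • m s.toNNReal ω
  eq_m : ∀ᵐ ω ∂P, ∀ t ∈ times T,
    m t ω = m₀ + ∫ s in (0 : ℝ)..t,
      ((∫ x, gradTheta ℓ (θ s.toNNReal ω) x ∂(P.map (X s.toNNReal)))
        - (γθ * ηθ) • m s.toNNReal ω)
  eq_X : ∀ᵐ ω ∂P, ∀ t ∈ times T,
    X t ω = (ξ ω).1 + ∫ s in (0 : ℝ)..t, ηx • U s.toNNReal ω
  eq_U : ∀ᵐ ω ∂P, ∀ t ∈ times T,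
    U t ω = (ξ ω).2 + (∫ s in (0 : ℝ)..t,
      (gradX ℓ (θ s.toNNReal ω) (X s.toNNReal ω) - (γx * ηx) • U s.toNNReal ω))
        + √(2 * γx) • W t ω

end MomentumFlow

end

/-! The noise is additive and the law of X enters only through one time-dependent vector, so no
stochastic integral is needed. On the product state space the system reads Z_t = N_t + ∫_0^t (B(Z_s)
+ 𝔼 C(Z_s)) ds for each ω, where N collects the initial data and the scaled noise, and B, C are
Lipschitz because the gradient of ℓ is.

Existence is a Picard iteration carried out at every ω. Errors are measured against exp((6L+1)t)
a(ω), with a square integrable and 𝔼 a ≤ 2 a(ω) for every ω. The second condition turns expectations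
back into pathwise bounds, and the weight makes each step halve the error on any horizon
(`norm_meanFieldStep_sub_le`, `exists_eq_meanFieldStep`). The limit is adapted and stays within a
square integrable envelope of N, which gives the second moments. Its parameters satisfy an equation
whose drift is the same for all ω, so they are deterministic (`parameters_unique`).

For uniqueness, let an arbitrary solution be given. The law of X_t is not random, so almost every
path of (θ, m) solves the same Lipschitz equation; the parameters, and with them the mean drift c,
are therefore deterministic up to a null set (`IsSolution.exists_meanDrift`). For two solutions with
drifts c and c', Grönwall along paths bounds the distance at time t by exp(Lt) ∫_0^t ‖c - c'‖
(`SolvesPath.norm_sub_le`). This bound is deterministic, so taking expectations requires no moments,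
and it makes ‖c - c'‖ at most a constant times its own primitive. A second Grönwall argument gives
zero. -/

/-! ### An integral Grönwall inequality -/

/-- Grönwall's inequality in integral form with an integrable forcing term. -/
theorem le_exp_mul_integral_of_le_integral {u k : ℝ → ℝ} {L t : ℝ} (hL : 0 ≤ L) (ht : 0 ≤ t)
    (hu : ContinuousOn u (Set.Icc 0 t)) (hk : IntervalIntegrable k volume 0 t)
    (hk0 : ∀ s ∈ Set.Icc 0 t, 0 ≤ k s)
    (h : ∀ s ∈ Set.Icc 0 t, u s ≤ ∫ r in (0 : ℝ)..s, (L * u r + k r)) :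
    u t ≤ Real.exp (L * t) * ∫ r in (0 : ℝ)..t, k r := by
  set κ := ∫ r in (0 : ℝ)..t, k r with hκ
  have huI : ∀ s ∈ Set.Icc 0 t, IntervalIntegrable u volume 0 s := fun s hs =>
    (hu.mono (by rw [Set.uIcc_of_le hs.1]; exact Set.Icc_subset_Icc_right hs.2)).intervalIntegrable
  -- Freezing the forcing at its total κ gives a majorant of `u` that is differentiable although `k`
  -- is only integrable. Since g' = L u ≤ L g, the function exp(-Ls) g(s) is antitone.
  set g : ℝ → ℝ := fun s => κ + L * ∫ r in (0 : ℝ)..s, u r with hg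
  have hug : ∀ s ∈ Set.Icc 0 t, u s ≤ g s := by
    intro s hs
    have hks : IntervalIntegrable k volume 0 s := hk.mono_set (by
      rw [Set.uIcc_of_le hs.1, Set.uIcc_of_le ht]; exact Set.Icc_subset_Icc_right hs.2)
    refine (h s hs).trans ?_
    rw [intervalIntegral.integral_add ((huI s hs).const_mul L) hks,
      intervalIntegral.integral_const_mul, add_comm]
    refine add_le_add ?_ le_rfl
    refine intervalIntegral.integral_mono_interval le_rfl hs.1 hs.2 ?_ hk
    filter_upwards [ae_restrict_mem measurableSet_Ioc] with r hr using hk0 r ⟨hr.1.le, hr.2⟩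
  have hgc : ContinuousOn g (Set.Icc 0 t) := by
    refine continuousOn_const.add (continuousOn_const.mul ?_)
    have := intervalIntegral.continuousOn_primitive_interval (μ := volume) (f := u) (a := 0) (b := t)
      (by rw [Set.uIcc_of_le ht]; exact hu.integrableOn_Icc)
    rwa [Set.uIcc_of_le ht] at this
  have hgd : ∀ s ∈ Set.Ioo 0 t, HasDerivAt g (L * u s) s := by
    intro s hs
    have hsI : s ∈ Set.Icc 0 t := Set.Ioo_subset_Icc_self hs
    have hc : ContinuousAt u s := hu.continuousAt (Icc_mem_nhds hs.1 hs.2)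
    refine HasDerivAt.const_add _ (HasDerivAt.const_mul _ ?_)
    refine intervalIntegral.integral_hasDerivAt_right (huI s hsI) ?_ hc
    exact (hu.mono Set.Ioo_subset_Icc_self).stronglyMeasurableAtFilter isOpen_Ioo s hs
  have hanti : AntitoneOn (fun s => Real.exp (-(L * s)) * g s) (Set.Icc 0 t) := by
    refine antitoneOn_of_hasDerivWithinAt_nonpos (convex_Icc 0 t)
      (f' := fun s => Real.exp (-(L * s)) * (-(L * 1)) * g s + Real.exp (-(L * s)) * (L * u s))
      (ContinuousOn.mul (by fun_prop) hgc) ?_ ?_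
    · intro s hs
      rw [interior_Icc] at hs
      exact ((((hasDerivAt_id s).const_mul L).neg.exp).mul (hgd s hs)).hasDerivWithinAt
    · intro s hs
      rw [interior_Icc] at hs
      have := hug s (Set.Ioo_subset_Icc_self hs)
      have h2 : 0 ≤ Real.exp (-(L * s)) * (L * (g s - u s)) :=
        mul_nonneg (Real.exp_pos _).le (mul_nonneg hL (sub_nonneg.2 this))
      nlinarith [h2]
  have h0t := hanti (Set.left_mem_Icc.2 ht) (Set.right_mem_Icc.2 ht) ht
  have hg0 : g 0 = κ := by simp [hg]
  simp only [mul_zero, neg_zero, Real.exp_zero, one_mul, hg0] at h0t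
  refine (hug t (Set.right_mem_Icc.2 ht)).trans ?_
  calc g t = Real.exp (L * t) * (Real.exp (-(L * t)) * g t) := by
        rw [← mul_assoc, ← Real.exp_add]; simp
    _ ≤ _ := by gcongr

/-- The difference of two primitives is controlled by an integrable forcing term as soon as the
integrands differ by at most a multiple of the difference plus that term. -/
theorem norm_sub_le_exp_mul_integral {E : Type*} [NormedAddCommGroup E] [NormedSpace ℝ E]
    {f g F G : ℝ → E} {k : ℝ → ℝ} {L t : ℝ} (hL : 0 ≤ L) (ht : 0 ≤ t)
    (hf : ContinuousOn f (Set.Icc 0 t)) (hg : ContinuousOn g (Set.Icc 0 t))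
    (hF : IntervalIntegrable F volume 0 t) (hG : IntervalIntegrable G volume 0 t)
    (hk : IntervalIntegrable k volume 0 t)
    (hk0 : ∀ s ∈ Set.Icc 0 t, 0 ≤ k s)
    (hfg : ∀ s ∈ Set.Icc 0 t, f s - g s = (∫ r in (0 : ℝ)..s, F r) - ∫ r in (0 : ℝ)..s, G r)
    (hFG : ∀ s ∈ Set.Icc 0 t, ‖F s - G s‖ ≤ L * ‖f s - g s‖ + k s) :
    ‖f t - g t‖ ≤ Real.exp (L * t) * ∫ r in (0 : ℝ)..t, k r := by
  refine le_exp_mul_integral_of_le_integral (u := fun s => ‖f s - g s‖) hL ht (hf.sub hg).norm hk hk0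
    fun s hs => ?_
  have hsub : Set.uIcc 0 s ⊆ Set.uIcc 0 t := by
    rw [Set.uIcc_of_le hs.1, Set.uIcc_of_le ht]; exact Set.Icc_subset_Icc_right hs.2
  have hcont : IntervalIntegrable (fun r => L * ‖f r - g r‖ + k r) volume 0 s :=
    (ContinuousOn.intervalIntegrable (by
      refine (continuousOn_const.mul (hf.sub hg).norm).mono ?_
      rwa [Set.uIcc_of_le ht] at hsub)).add (hk.mono_set hsub)
  rw [hfg s hs, ← intervalIntegral.integral_sub (hF.mono_set hsub) (hG.mono_set hsub)]
  refine (intervalIntegral.norm_integral_le_integral_norm hs.1).trans ?_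
  refine intervalIntegral.integral_mono_on hs.1
    ((hF.mono_set hsub).sub (hG.mono_set hsub)).norm hcont fun r hr => ?_
  exact hFG r ⟨hr.1, hr.2.trans hs.2⟩

/-- A nonnegative continuous function dominated by a multiple of its primitive vanishes. -/
theorem eq_zero_of_le_integral {u : ℝ → ℝ} {L t : ℝ} (hL : 0 ≤ L) (ht : 0 ≤ t)
    (hu : ContinuousOn u (Set.Icc 0 t)) (hu0 : 0 ≤ u t)
    (h : ∀ s ∈ Set.Icc 0 t, u s ≤ ∫ r in (0 : ℝ)..s, L * u r) : u t = 0 := by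
  refine le_antisymm ?_ hu0
  simpa using le_exp_mul_integral_of_le_integral (k := fun _ => 0) hL ht hu
    intervalIntegrable_const (fun _ _ => le_rfl) (by simpa using h)

/-- The Cauchy–Schwarz inequality for the integral of a continuous function over `[0, T]`. -/
theorem sq_integral_le_mul_integral_sq {f : ℝ → ℝ} {T : ℝ} (hT : 0 ≤ T)
    (hf : ContinuousOn f (Set.Icc 0 T)) :
    (∫ s in (0 : ℝ)..T, f s) ^ 2 ≤ T * ∫ s in (0 : ℝ)..T, f s ^ 2 := by
  rcases hT.eq_or_lt with rfl | hT
  · simp only [intervalIntegral.integral_same]; norm_num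
  rw [← Set.uIcc_of_le hT.le] at hf
  set I := ∫ s in (0 : ℝ)..T, f s with hI
  -- Expanding this square yields T (T ∫ f² - I²) ≥ 0.
  have h0 : 0 ≤ ∫ s in (0 : ℝ)..T, (T * f s - I) ^ 2 :=
    intervalIntegral.integral_nonneg hT.le fun _ _ => sq_nonneg _
  have h1 : ∫ s in (0 : ℝ)..T, (T * f s - I) ^ 2
      = T ^ 2 * (∫ s in (0 : ℝ)..T, f s ^ 2) - 2 * T * I * I + I ^ 2 * T := by
    have : (fun s => (T * f s - I) ^ 2) = fun s => (T ^ 2 * f s ^ 2 - 2 * T * I * f s) + I ^ 2 := by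
      ext s; ring
    rw [this, intervalIntegral.integral_add, intervalIntegral.integral_sub,
      intervalIntegral.integral_const_mul, intervalIntegral.integral_const_mul,
      intervalIntegral.integral_const, ← hI]
    · simp; ring
    · exact ((hf.pow 2).intervalIntegrable).const_mul _
    · exact hf.intervalIntegrable.const_mul _
    · exact (((hf.pow 2).intervalIntegrable).const_mul _).sub (hf.intervalIntegrable.const_mul _)
    · simp
  have h2 : 0 ≤ T * (T * (∫ s in (0 : ℝ)..T, f s ^ 2) - I ^ 2) := by nlinarith
  nlinarith [nonneg_of_mul_nonneg_right h2 hT]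

/-! ### Completion of a filtration -/

section Completion

variable {Ω : Type*} {mΩ : MeasurableSpace Ω}

/-- The filtration obtained from an increasing family of σ-algebras by adjoining the measurable sets
that agree almost surely with one of its members. -/
@[reducible]
def completedFiltration (P : Measure Ω) (𝓖 : ℝ≥0 → MeasurableSpace Ω) (h𝓖 : Monotone 𝓖) :
    Filtration ℝ≥0 mΩ where
  seq t := eventuallyMeasurableSpace (𝓖 t) (ae P) ⊓ mΩ
  mono' := fun _ _ hst s hs => by
    obtain ⟨⟨t, ht, hst'⟩, hs⟩ := MeasurableSpace.measurableSet_inf.1 hs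
    exact MeasurableSpace.measurableSet_inf.2 ⟨⟨t, h𝓖 hst _ ht, hst'⟩, hs⟩
  le' := fun _ => inf_le_right

theorem measurableSet_completedFiltration {P : Measure Ω} {𝓖 : ℝ≥0 → MeasurableSpace Ω}
    {h𝓖 : Monotone 𝓖} {t : ℝ≥0} {s : Set Ω} :
    MeasurableSet[completedFiltration P 𝓖 h𝓖 t] s ↔
      (∃ r, MeasurableSet[𝓖 t] r ∧ s =ᵐ[P] r) ∧ MeasurableSet s :=
  MeasurableSpace.measurableSet_inf

theorem le_completedFiltration (P : Measure Ω) {𝓖 : ℝ≥0 → MeasurableSpace Ω}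
    (h𝓖 : Monotone 𝓖) (hle : ∀ t, 𝓖 t ≤ mΩ) (t : ℝ≥0) :
    𝓖 t ≤ completedFiltration P 𝓖 h𝓖 t := fun s hs =>
  measurableSet_completedFiltration.2 ⟨⟨s, hs, Filter.EventuallyEq.rfl⟩, hle t _ hs⟩

/-- Sets of the completion agree almost surely with sets of `𝓖 t`, so each simple approximant has a
`𝓖 t`-measurable version. The limit of these versions is `𝓖 t`-measurable, with the default value of
`limUnder` where they diverge, and equals `f` off a null set. -/
theorem aestronglyMeasurable_of_completedFiltration {P : Measure Ω} {𝓖 : ℝ≥0 → MeasurableSpace Ω}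
    {h𝓖 : Monotone 𝓖} {t : ℝ≥0} {E : Type*} [NormedAddCommGroup E] [CompleteSpace E] {f : Ω → E}
    (hf : StronglyMeasurable[completedFiltration P 𝓖 h𝓖 t] f) :
    AEStronglyMeasurable[𝓖 t] f P := by
  have hsimple : ∀ g : @SimpleFunc Ω (completedFiltration P 𝓖 h𝓖 t) E,
      AEStronglyMeasurable[𝓖 t] g P := by
    intro g
    induction g using SimpleFunc.induction with
    | @const c s hs =>
      obtain ⟨⟨r, hr, hsr⟩, -⟩ := measurableSet_completedFiltration.1 hs
      refine ⟨r.indicator fun _ => c, stronglyMeasurable_const.indicator hr, ?_⟩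
      have h1 := indicator_ae_eq_of_ae_eq_set (f := fun _ => c) hsr
      refine Filter.EventuallyEq.trans (Filter.Eventually.of_forall fun ω => ?_) h1
      by_cases hω : ω ∈ s <;> simp [hω]
    | add _ hf hg => exact hf.add hg
  choose g hgm hg using fun n => hsimple (hf.approx n)
  have hlim : ∀ᵐ ω ∂P, Filter.Tendsto (fun n => g n ω) Filter.atTop (nhds (f ω)) := by
    filter_upwards [ae_all_iff.2 hg] with ω hω
    simpa only [← hω] using hf.tendsto_approx ω
  refine ⟨fun ω => Filter.limUnder Filter.atTop fun n => g n ω, @StronglyMeasurable.limUnder _ _ _ (𝓖 t) _ _ _ _ _ _ _ hgm, ?_⟩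
  filter_upwards [hlim] with ω hω using hω.limUnder_eq.symm

end Completion

namespace MomentumFlow

/-! ### Second moments of the Wiener process -/

theorem integral_norm_sq_multivariateGaussian {d : ℕ} {S : Matrix (Fin d) (Fin d) ℝ}
    (hS : S.PosSemidef) :
    ∫ x, ‖x‖ ^ 2 ∂(multivariateGaussian (0 : Vec d) S) = S.trace := by
  have hcoord : ∀ i : Fin d, MemLp (fun x : Vec d => x i) 2 (multivariateGaussian 0 S) := fun i =>
    (EuclideanSpace.proj (𝕜 := ℝ) i : Vec d →L[ℝ] ℝ).comp_memLp' IsGaussian.memLp_two_id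
  have hmean : ∀ i : Fin d, ∫ x : Vec d, x i ∂(multivariateGaussian 0 S) = 0 := fun i => by
    have := (EuclideanSpace.proj (𝕜 := ℝ) i : Vec d →L[ℝ] ℝ).integral_comp_id_comm
      (μ := multivariateGaussian 0 S) IsGaussian.integrable_id
    simpa using this
  simp_rw [EuclideanSpace.real_norm_sq_eq]
  rw [integral_finsetSum _ fun i _ => (hcoord i).integrable_sq, Matrix.trace]
  refine Finset.sum_congr rfl fun i _ => ?_
  rw [← variance_of_integral_eq_zero (hcoord i).aemeasurable (hmean i),
    variance_eval_multivariateGaussian hS, Matrix.diag]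

variable {Ω : Type*} {mΩ : MeasurableSpace Ω} {P : Measure Ω} {d : ℕ}
  {𝓕 : Filtration ℝ≥0 mΩ} {W : ℝ≥0 → Ω → Vec d}

theorem IsWiener.hasLaw (hW : IsWiener P 𝓕 W) (t : ℝ≥0) :
    HasLaw (W t) (multivariateGaussian 0 ((t : ℝ) • (1 : Matrix (Fin d) (Fin d) ℝ))) P := by
  have h := hW.law 0 t zero_le
  simp only [NNReal.coe_zero, sub_zero] at h
  refine h.congr ?_
  filter_upwards [hW.zero] with ω hω
  simp [hω]

theorem IsWiener.memLp (hW : IsWiener P 𝓕 W) (t : ℝ≥0) : MemLp (W t) 2 P := by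
  have h := (hW.hasLaw t)
  have h2 : MemLp id 2 (P.map (W t)) := by
    rw [h.map_eq]; exact IsGaussian.memLp_two_id
  exact (memLp_map_measure_iff h2.1 h.aemeasurable).1 h2

theorem IsWiener.integral_norm_sq (hW : IsWiener P 𝓕 W) (t : ℝ≥0) :
    ∫ ω, ‖W t ω‖ ^ 2 ∂P = d * t := by
  have h := (hW.hasLaw t).integral_comp (f := fun x => ‖x‖ ^ 2) (by fun_prop)
  have hS : ((t : ℝ) • (1 : Matrix (Fin d) (Fin d) ℝ)).PosSemidef :=
    Matrix.PosSemidef.one.smul t.2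
  rw [integral_norm_sq_multivariateGaussian hS] at h
  simpa [Function.comp_def, mul_comm] using h

/-! ### Partial gradients -/

variable {dθ dx : ℕ} {ℓ : Vec dθ → Vec dx → ℝ} {K : ℝ}

/-- Chain rule along θ' ↦ (θ', x), whose derivative pairs only with the first component of the full
gradient. -/
theorem gradTheta_eq_fst (h : Differentiable ℝ (jointPotential ℓ)) (θ : Vec dθ) (x : Vec dx) :
    gradTheta ℓ θ x = (gradient (jointPotential ℓ) (WithLp.toLp 2 (θ, x))).fst := by
  refine HasGradientAt.gradient ?_
  rw [hasGradientAt_iff_hasFDerivAt]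
  have h1 := (h (WithLp.toLp 2 (θ, x))).hasGradientAt.hasFDerivAt
  have h2 : HasFDerivAt (fun θ' : Vec dθ => WithLp.toLp 2 (θ', x))
      ((WithLp.prodContinuousLinearEquiv 2 ℝ (Vec dθ) (Vec dx)).symm.toContinuousLinearMap ∘L
        ContinuousLinearMap.inl ℝ (Vec dθ) (Vec dx)) θ :=
    ((WithLp.prodContinuousLinearEquiv 2 ℝ (Vec dθ) (Vec dx)).symm.hasFDerivAt).comp θ (hasFDerivAt_prodMk_left θ x)
  refine (h1.comp θ h2).congr_fderiv ?_
  generalize gradient (jointPotential ℓ) (WithLp.toLp 2 (θ, x)) = g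
  ext v
  simp [WithLp.prod_inner_apply]

theorem gradX_eq_snd (h : Differentiable ℝ (jointPotential ℓ)) (θ : Vec dθ) (x : Vec dx) :
    gradX ℓ θ x = (gradient (jointPotential ℓ) (WithLp.toLp 2 (θ, x))).snd := by
  refine HasGradientAt.gradient ?_
  rw [hasGradientAt_iff_hasFDerivAt]
  have h1 := (h (WithLp.toLp 2 (θ, x))).hasGradientAt.hasFDerivAt
  have h2 : HasFDerivAt (fun x' : Vec dx => WithLp.toLp 2 (θ, x'))
      ((WithLp.prodContinuousLinearEquiv 2 ℝ (Vec dθ) (Vec dx)).symm.toContinuousLinearMap ∘L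
        ContinuousLinearMap.inr ℝ (Vec dθ) (Vec dx)) x :=
    ((WithLp.prodContinuousLinearEquiv 2 ℝ (Vec dθ) (Vec dx)).symm.hasFDerivAt).comp x (hasFDerivAt_prodMk_right θ x)
  refine (h1.comp x h2).congr_fderiv ?_
  generalize gradient (jointPotential ℓ) (WithLp.toLp 2 (θ, x)) = g
  ext v
  simp [WithLp.prod_inner_apply]

/-- The partial gradients are components of the full one. Passing between the Euclidean and the sup
norm on the product changes the constant, so only some `L` is asserted. -/
theorem HasLipschitzGradient.exists_lipschitzWith (h : HasLipschitzGradient ℓ K) :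
    ∃ L : ℝ≥0, LipschitzWith L (fun p : Vec dθ × Vec dx => gradTheta ℓ p.1 p.2) ∧
      LipschitzWith L (fun p : Vec dθ × Vec dx => gradX ℓ p.1 p.2) := by
  have hgrad : LipschitzWith K.toNNReal (gradient (jointPotential ℓ)) :=
    LipschitzWith.of_dist_le' fun z z' => by simpa [dist_eq_norm] using h.2 z z'
  have hcomp := hgrad.comp (WithLp.prod_lipschitzWith_toLp 2 (Vec dθ) (Vec dx))
  have hcomp' := (WithLp.prod_lipschitzWith_ofLp 2 (Vec dθ) (Vec dx)).comp hcomp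
  have hθ := LipschitzWith.prod_fst.comp hcomp'
  have hx := LipschitzWith.prod_snd.comp hcomp'
  have eθ : Prod.fst ∘ WithLp.ofLp ∘ gradient (jointPotential ℓ) ∘ WithLp.toLp 2
      = fun p : Vec dθ × Vec dx => gradTheta ℓ p.1 p.2 :=
    funext fun p => (gradTheta_eq_fst h.1 p.1 p.2).symm
  have ex : Prod.snd ∘ WithLp.ofLp ∘ gradient (jointPotential ℓ) ∘ WithLp.toLp 2
      = fun p : Vec dθ × Vec dx => gradX ℓ p.1 p.2 :=
    funext fun p => (gradX_eq_snd h.1 p.1 p.2).symm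
  rw [eθ] at hθ
  rw [ex] at hx
  exact ⟨_, hθ, hx⟩

/-! ### Mean-field integral equations with additive noise -/

section MeanField

variable {Ω : Type*} {mΩ : MeasurableSpace Ω} {E : Type*} [NormedAddCommGroup E]

theorem norm_le_of_lipschitzWith {F : E → E} {L : ℝ≥0} (hF : LipschitzWith L F) (x : E) :
    ‖F x‖ ≤ ‖F 0‖ + L * ‖x‖ := by
  have := hF.dist_le_mul x 0
  rw [dist_zero_right, dist_eq_norm] at this
  linarith [norm_sub_norm_le (F x) (F 0)]

/-- Additive noise terms: adapted continuous processes with enough square integrability. -/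
structure IsDriver (P : Measure Ω) (𝓗 : Filtration ℝ≥0 mΩ) (N : ℝ≥0 → Ω → E) : Prop where
  adapted : ∀ t, StronglyMeasurable[𝓗 t] (N t)
  cont : ∀ ω, Continuous fun t => N t ω
  memLp : ∀ t, MemLp (N t) 2 P
  bdd : ∀ T : ℝ≥0, ∃ c : ℝ, ∀ t ≤ T, ∫ ω, ‖N t ω‖ ∂P ≤ c
  path : ∀ T : ℝ≥0, MemLp (fun ω => ∫ s in (0 : ℝ)..T, ‖N s.toNNReal ω‖) 2 P

/-- Adapted continuous processes within locally uniform `L²` distance of the noise term. -/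
structure IsAdmissible (P : Measure Ω) (𝓗 : Filtration ℝ≥0 mΩ) (N Z : ℝ≥0 → Ω → E) : Prop where
  adapted : ∀ t, StronglyMeasurable[𝓗 t] (Z t)
  cont : ∀ ω, Continuous fun t => Z t ω
  bound : ∀ T : ℝ≥0, ∃ a : Ω → ℝ, MemLp a 2 P ∧ ∀ t ≤ T, ∀ ω, ‖Z t ω - N t ω‖ ≤ a ω

variable {P : Measure Ω} {𝓗 : Filtration ℝ≥0 mΩ} {B C : E → E} {N Z Z' : ℝ≥0 → Ω → E} {L : ℝ≥0}

theorem IsDriver.isAdmissible (hN : IsDriver P 𝓗 N) : IsAdmissible P 𝓗 N N where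
  adapted := hN.adapted
  cont := hN.cont
  bound := fun _ => ⟨0, MemLp.zero, by simp⟩

theorem IsAdmissible.memLp (hN : IsDriver P 𝓗 N) (hZ : IsAdmissible P 𝓗 N Z) (t : ℝ≥0) : MemLp (Z t) 2 P := by
  obtain ⟨a, ha, hb⟩ := hZ.bound t
  have h1 : MemLp (fun ω => Z t ω - N t ω) 2 P :=
    ha.mono' (((hZ.adapted t).mono (𝓗.le t)).sub ((hN.adapted t).mono (𝓗.le t))).aestronglyMeasurable
      (Filter.Eventually.of_forall (hb t le_rfl))
  have h2 := h1.add (hN.memLp t)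
  have h3 : (fun ω => Z t ω - N t ω) + N t = Z t := by ext ω; simp
  rwa [h3] at h2

theorem IsAdmissible.continuous_comp (hZ : IsAdmissible P 𝓗 N Z) (hB : LipschitzWith L B) (ω : Ω) :
    Continuous fun s : ℝ => B (Z s.toNNReal ω) :=
  hB.continuous.comp ((hZ.cont ω).comp continuous_real_toNNReal)

theorem IsAdmissible.integrable_comp [IsProbabilityMeasure P] (hN : IsDriver P 𝓗 N) (hZ : IsAdmissible P 𝓗 N Z)
    (hC : LipschitzWith L C) (t : ℝ≥0) : Integrable (fun ω => C (Z t ω)) P := by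
  have h1 := (hZ.memLp hN t).integrable one_le_two
  refine ((integrable_const ‖C 0‖).add (h1.norm.const_mul (L : ℝ))).mono'
    (hC.continuous.comp_aestronglyMeasurable h1.1) (Filter.Eventually.of_forall fun ω => ?_)
  exact norm_le_of_lipschitzWith hC _

variable [NormedSpace ℝ E]

/-- Stopping the path at `t`, through `min s t`, makes it jointly measurable with respect to the
single σ-algebra `m`. Integrating in time thus preserves adaptedness, not merely measurability. -/
theorem stronglyMeasurable_integral_path {m : MeasurableSpace Ω} {Y : ℝ≥0 → Ω → E} {t : ℝ≥0}
    (hY : ∀ s ≤ t, StronglyMeasurable (Y s)) (hc : ∀ ω, Continuous fun s => Y s ω) :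
    StronglyMeasurable fun ω => ∫ s in (0 : ℝ)..t, Y s.toNNReal ω := by
  have hjoint : StronglyMeasurable (Function.uncurry fun (s : ℝ≥0) ω => Y (min s t) ω) :=
    stronglyMeasurable_uncurry_of_continuous_of_stronglyMeasurable
      (fun ω => (hc ω).comp (continuous_id.min continuous_const)) fun s => hY _ (min_le_right s t)
  have hjoint' : StronglyMeasurable fun p : Ω × ℝ => Y (min p.2.toNNReal t) p.1 :=
    hjoint.comp_measurable
      ((measurable_real_toNNReal.comp measurable_snd).prodMk measurable_fst)
  have := hjoint'.integral_prod_right' (ν := volume.restrict (Set.Ioc 0 (t : ℝ)))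
  convert this using 2 with ω
  rw [intervalIntegral.integral_of_le t.coe_nonneg]
  refine setIntegral_congr_fun measurableSet_Ioc fun s hs => ?_
  simp only
  rw [min_eq_left (Real.toNNReal_le_iff_le_coe.2 hs.2)]

/-- The right-hand side of the integral equation
`Z_t = N_t + ∫_0^t (B(Z_s) + 𝔼 C(Z_s)) ds`. -/
noncomputable def meanFieldStep (P : Measure Ω) (B C : E → E) (N Z : ℝ≥0 → Ω → E) (t : ℝ≥0) (ω : Ω) : E :=
  N t ω + ∫ s in (0 : ℝ)..t, (B (Z s.toNNReal ω) + ∫ ω', C (Z s.toNNReal ω') ∂P)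

variable [IsProbabilityMeasure P]

namespace IsAdmissible

/-- `C` grows at most linearly, `Z` stays within an integrable envelope of `N` up to time `T`, and
the first moment of `N` is locally bounded. -/
theorem exists_norm_mean_le (hN : IsDriver P 𝓗 N) (hZ : IsAdmissible P 𝓗 N Z)
    (hC : LipschitzWith L C) (T : ℝ≥0) :
    ∃ M : ℝ, ∀ t ≤ T, ‖∫ ω, C (Z t ω) ∂P‖ ≤ M := by
  obtain ⟨a, ha, hb⟩ := hZ.bound T
  obtain ⟨c, hc⟩ := hN.bdd T
  refine ⟨‖C 0‖ + L * (c + ∫ ω, a ω ∂P), fun t ht => ?_⟩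
  have haI := ha.integrable one_le_two
  have hNI := ((hN.memLp t).integrable one_le_two).norm
  refine (norm_integral_le_integral_norm _).trans ?_
  have hle : ∀ ω, ‖C (Z t ω)‖ ≤ ‖C 0‖ + L * (‖N t ω‖ + a ω) := fun ω => by
    refine (norm_le_of_lipschitzWith hC _).trans ?_
    gcongr
    have := norm_sub_norm_le (Z t ω) (N t ω)
    linarith [hb t ht ω]
  have hI : Integrable (fun ω => (L : ℝ) * (‖N t ω‖ + a ω)) P := (hNI.add haI).const_mul _
  refine (integral_mono (hZ.integrable_comp hN hC t).norm ((integrable_const _).add hI) hle).trans ?_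
  simp only [Pi.add_apply]
  rw [integral_add (integrable_const _) hI, integral_const_mul, integral_add hNI haI]
  simp only [integral_const, probReal_univ, one_smul]
  gcongr
  exact hc t ht

/-- Joint measurability and a local bound suffice; continuity of the mean in time is not needed. -/
theorem intervalIntegrable_mean (hN : IsDriver P 𝓗 N) (hZ : IsAdmissible P 𝓗 N Z)
    (hC : LipschitzWith L C) (a b : ℝ) :
    IntervalIntegrable (fun s : ℝ => ∫ ω, C (Z s.toNNReal ω) ∂P) volume a b := by
  have hjoint : StronglyMeasurable (Function.uncurry Z) :=
    stronglyMeasurable_uncurry_of_continuous_of_stronglyMeasurable hZ.cont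
      fun t => (hZ.adapted t).mono (𝓗.le t)
  have hmeas : StronglyMeasurable fun s : ℝ => ∫ ω, C (Z s.toNNReal ω) ∂P :=
    ((hC.continuous.comp_stronglyMeasurable hjoint).integral_prod_right'
      (ν := P)).comp_measurable measurable_real_toNNReal
  obtain ⟨M, hM⟩ := hZ.exists_norm_mean_le hN hC (max a b).toNNReal
  refine (intervalIntegrable_const (c := M)).mono_fun' hmeas.aestronglyMeasurable ?_
  filter_upwards [ae_restrict_mem measurableSet_uIoc] with s hs
  exact hM _ (Real.toNNReal_le_toNNReal hs.2)

theorem intervalIntegrable_drift (hN : IsDriver P 𝓗 N) (hZ : IsAdmissible P 𝓗 N Z)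
    (hB : LipschitzWith L B) (hC : LipschitzWith L C) (ω : Ω) (a b : ℝ) :
    IntervalIntegrable (fun s : ℝ => B (Z s.toNNReal ω) + ∫ ω', C (Z s.toNNReal ω') ∂P)
      volume a b :=
  ((hZ.continuous_comp hB ω).intervalIntegrable a b).add (hZ.intervalIntegrable_mean hN hC a b)

/-- By linear growth, the integrated local drift is controlled by the time integral of ‖N‖, square
integrable by `IsDriver.path`, together with the old envelope; the mean drift adds only a constant.
Integrating the bound up to `T` removes the dependence on `t`. -/
theorem exists_norm_meanFieldStep_sub_le (hN : IsDriver P 𝓗 N) (hZ : IsAdmissible P 𝓗 N Z)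
    (hB : LipschitzWith L B) (hC : LipschitzWith L C) (T : ℝ≥0) :
    ∃ a : Ω → ℝ, MemLp a 2 P ∧
      ∀ t ≤ T, ∀ ω, ‖MomentumFlow.meanFieldStep P B C N Z t ω - N t ω‖ ≤ a ω := by
  obtain ⟨a, ha, hb⟩ := hZ.bound T
  obtain ⟨M, hM⟩ := hZ.exists_norm_mean_le hN hC T
  have hmem : MemLp (fun ω => T * (‖B 0‖ + M)
      + (L * (∫ s in (0 : ℝ)..T, ‖N s.toNNReal ω‖) + T * (L * a ω))) 2 P :=
    MemLp.add (memLp_const _)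
      (((hN.path T).const_mul (L : ℝ)).add ((ha.const_mul (L : ℝ)).const_mul (T : ℝ)))
  refine ⟨_, hmem, fun t ht ω => ?_⟩
  have ht' : (t : ℝ) ≤ T := NNReal.coe_le_coe.2 ht
  have hNc : Continuous fun s : ℝ => ‖N s.toNNReal ω‖ :=
    ((hN.cont ω).comp continuous_real_toNNReal).norm
  have hint : ∀ u v : ℝ, IntervalIntegrable
      (fun s : ℝ => (‖B 0‖ + M) + (L * ‖N s.toNNReal ω‖ + L * a ω)) volume u v := fun u v =>
    Continuous.intervalIntegrable (by fun_prop) u v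
  have hle : ∀ s ∈ Set.Icc (0 : ℝ) T, ‖B (Z s.toNNReal ω) + ∫ ω', C (Z s.toNNReal ω') ∂P‖
      ≤ (‖B 0‖ + M) + (L * ‖N s.toNNReal ω‖ + L * a ω) := by
    intro s hs
    have hsT : s.toNNReal ≤ T := Real.toNNReal_le_iff_le_coe.2 hs.2
    have h1 := norm_sub_norm_le (Z s.toNNReal ω) (N s.toNNReal ω)
    have h2 : (L : ℝ) * ‖Z s.toNNReal ω‖ ≤ L * (‖N s.toNNReal ω‖ + a ω) := by
      gcongr
      linarith [hb _ hsT ω]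
    linarith [norm_add_le (B (Z s.toNNReal ω)) (∫ ω', C (Z s.toNNReal ω') ∂P), hM _ hsT,
      norm_le_of_lipschitzWith hB (Z s.toNNReal ω)]
  have hnn : ∀ s ∈ Set.Icc (0 : ℝ) T, 0 ≤ (‖B 0‖ + M) + (L * ‖N s.toNNReal ω‖ + L * a ω) :=
    fun s hs => (norm_nonneg _).trans (hle s hs)
  simp only [MomentumFlow.meanFieldStep, add_sub_cancel_left]
  calc ‖∫ s in (0 : ℝ)..t, (B (Z s.toNNReal ω) + ∫ ω', C (Z s.toNNReal ω') ∂P)‖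
      ≤ ∫ s in (0 : ℝ)..t, ‖B (Z s.toNNReal ω) + ∫ ω', C (Z s.toNNReal ω') ∂P‖ :=
        intervalIntegral.norm_integral_le_integral_norm t.coe_nonneg
    _ ≤ ∫ s in (0 : ℝ)..t, ((‖B 0‖ + M) + (L * ‖N s.toNNReal ω‖ + L * a ω)) :=
        intervalIntegral.integral_mono_on t.coe_nonneg (hZ.intervalIntegrable_drift hN hB hC ω _ _).norm
          (hint _ _) fun s hs => hle s ⟨hs.1, hs.2.trans ht'⟩
    _ ≤ ∫ s in (0 : ℝ)..T, ((‖B 0‖ + M) + (L * ‖N s.toNNReal ω‖ + L * a ω)) := by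
        refine intervalIntegral.integral_mono_interval le_rfl t.coe_nonneg ht' ?_ (hint _ _)
        filter_upwards [ae_restrict_mem measurableSet_Ioc] with s hs using
          hnn s ⟨hs.1.le, hs.2⟩
    _ = _ := by
        have h1 := intervalIntegral.integral_add (μ := volume) (a := 0) (b := T)
          (f := fun _ => ‖B 0‖ + M) (g := fun s => L * ‖N s.toNNReal ω‖ + L * a ω) (by simp)
          (Continuous.intervalIntegrable (by fun_prop) _ _)
        have h2 := intervalIntegral.integral_add (μ := volume) (a := 0) (b := T)
          (f := fun s => L * ‖N s.toNNReal ω‖) (g := fun _ => L * a ω)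
          (Continuous.intervalIntegrable (by fun_prop) _ _) (by simp)
        rw [h1, h2]
        simp only [intervalIntegral.integral_const, intervalIntegral.integral_const_mul, sub_zero,
          smul_eq_mul]
        ring

theorem meanFieldStep (hN : IsDriver P 𝓗 N) (hZ : IsAdmissible P 𝓗 N Z)
    (hB : LipschitzWith L B) (hC : LipschitzWith L C) :
    IsAdmissible P 𝓗 N (meanFieldStep P B C N Z) where
  adapted t := by
    refine (hN.adapted t).add ?_
    have : (fun ω => ∫ s in (0 : ℝ)..t, (B (Z s.toNNReal ω) + ∫ ω', C (Z s.toNNReal ω') ∂P))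
        = fun ω => (∫ s in (0 : ℝ)..t, B (Z s.toNNReal ω))
          + ∫ s in (0 : ℝ)..t, ∫ ω', C (Z s.toNNReal ω') ∂P := by
      ext ω
      exact intervalIntegral.integral_add ((hZ.continuous_comp hB ω).intervalIntegrable _ _)
        (hZ.intervalIntegrable_mean hN hC _ _)
    rw [this]
    refine StronglyMeasurable.add ?_ stronglyMeasurable_const
    exact stronglyMeasurable_integral_path (Y := fun s ω => B (Z s ω))
      (fun s hs => hB.continuous.comp_stronglyMeasurable ((hZ.adapted s).mono (𝓗.mono hs)))
      fun ω => hB.continuous.comp (hZ.cont ω)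
  cont ω := by
    refine (hN.cont ω).add ?_
    exact (intervalIntegral.continuous_primitive
      (hZ.intervalIntegrable_drift hN hB hC ω) 0).comp NNReal.continuous_coe
  bound T := hZ.exists_norm_meanFieldStep_sub_le hN hB hC T

end IsAdmissible

/-- This is the contraction estimate. The local drift contributes a factor L and the mean drift 2L,
because `ha2` bounds the expectation of `a` by 2 a(ω). Integrating 3L exp(cs) gains 3L/c, which is
at most 1/2 for c = 6L + 1; the summand 1 keeps c positive when L = 0. -/
theorem norm_meanFieldStep_sub_le (hN : IsDriver P 𝓗 N) (hZ : IsAdmissible P 𝓗 N Z)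
    (hZ' : IsAdmissible P 𝓗 N Z') (hB : LipschitzWith L B) (hC : LipschitzWith L C)
    {T : ℝ≥0} {a : Ω → ℝ} (ha : Integrable a P) (ha0 : ∀ ω, 0 ≤ a ω)
    (ha2 : ∀ ω, ∫ ω', a ω' ∂P ≤ 2 * a ω) {R : ℝ} (hR : 0 ≤ R)
    (h : ∀ t ≤ T, ∀ ω, ‖Z t ω - Z' t ω‖ ≤ R * Real.exp ((6 * L + 1) * t) * a ω)
    (t : ℝ≥0) (ht : t ≤ T) (ω : Ω) :
    ‖meanFieldStep P B C N Z t ω - meanFieldStep P B C N Z' t ω‖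
      ≤ R / 2 * Real.exp ((6 * L + 1) * t) * a ω := by
  set c : ℝ := 6 * L + 1 with hc
  have hc0 : 0 < c := by positivity
  have hpt : ∀ s ∈ Set.Icc (0 : ℝ) t,
      ‖(B (Z s.toNNReal ω) + ∫ ω', C (Z s.toNNReal ω') ∂P)
        - (B (Z' s.toNNReal ω) + ∫ ω', C (Z' s.toNNReal ω') ∂P)‖
      ≤ 3 * L * R * a ω * Real.exp (c * s) := by
    intro s hs
    have hsT : s.toNNReal ≤ T := (Real.toNNReal_le_iff_le_coe.2 hs.2).trans ht
    have hscoe : ((s.toNNReal : ℝ≥0) : ℝ) = s := Real.coe_toNNReal _ hs.1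
    have hh := h _ hsT
    rw [hscoe] at hh
    have h1 : ‖B (Z s.toNNReal ω) - B (Z' s.toNNReal ω)‖ ≤ L * (R * Real.exp (c * s) * a ω) := by
      refine (hB.norm_sub_le _ _).trans ?_
      gcongr
      exact hh ω
    have h2 : ‖(∫ ω', C (Z s.toNNReal ω') ∂P) - ∫ ω', C (Z' s.toNNReal ω') ∂P‖
        ≤ L * (R * Real.exp (c * s)) * (2 * a ω) := by
      rw [← integral_sub (hZ.integrable_comp hN hC _) (hZ'.integrable_comp hN hC _)]
      refine (norm_integral_le_of_norm_le (ha.const_mul (L * (R * Real.exp (c * s))))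
        (Filter.Eventually.of_forall fun ω' => ?_)).trans ?_
      · refine (hC.norm_sub_le _ _).trans ?_
        rw [mul_assoc]
        gcongr
        exact hh ω'
      · rw [integral_const_mul]
        gcongr
        exact ha2 ω
    rw [add_sub_add_comm]
    refine (norm_add_le _ _).trans ((add_le_add h1 h2).trans (le_of_eq ?_))
    ring
  have hexp : ∫ s in (0 : ℝ)..t, Real.exp (c * s) = (Real.exp (c * t) - 1) / c := by
    have hd : ∀ s ∈ Set.uIcc (0 : ℝ) t,
        HasDerivAt (fun s => Real.exp (c * s) / c) (Real.exp (c * s)) s := fun s _ => by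
      have := (((hasDerivAt_id s).const_mul c).exp).div_const c
      simpa [hc0.ne'] using this
    rw [intervalIntegral.integral_eq_sub_of_hasDerivAt hd
      (Continuous.intervalIntegrable (by fun_prop) _ _)]
    simp [sub_div]
  simp only [meanFieldStep, add_sub_add_left_eq_sub]
  rw [← intervalIntegral.integral_sub (hZ.intervalIntegrable_drift hN hB hC ω _ _)
    (hZ'.intervalIntegrable_drift hN hB hC ω _ _)]
  refine (intervalIntegral.norm_integral_le_integral_norm t.coe_nonneg).trans ?_
  refine (intervalIntegral.integral_mono_on t.coe_nonneg
    ((hZ.intervalIntegrable_drift hN hB hC ω _ _).sub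
      (hZ'.intervalIntegrable_drift hN hB hC ω _ _)).norm
    (Continuous.intervalIntegrable (by fun_prop) _ _) hpt).trans ?_
  rw [intervalIntegral.integral_const_mul]
  erw [hexp]
  have hq : 3 * L / c ≤ (1 / 2 : ℝ) := by
    rw [div_le_iff₀ hc0, hc]; linarith
  have hRa : 0 ≤ R * a ω := mul_nonneg hR (ha0 ω)
  calc 3 * L * R * a ω * ((Real.exp (c * t) - 1) / c)
      = (3 * L / c) * ((R * a ω) * (Real.exp (c * t) - 1)) := by ring
    _ ≤ (1 / 2) * ((R * a ω) * (Real.exp (c * t) - 1)) := by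
        gcongr
        refine mul_nonneg hRa (sub_nonneg.2 (Real.one_le_exp (by positivity)))
    _ ≤ (1 / 2) * ((R * a ω) * Real.exp (c * t)) := by
        gcongr
        linarith
    _ = _ := by ring

/-- Existence for mean-field equations with Lipschitz coefficients and additive noise. -/
theorem exists_eq_meanFieldStep [CompleteSpace E] (hN : IsDriver P 𝓗 N)
    (hB : LipschitzWith L B) (hC : LipschitzWith L C) :
    ∃ Z, IsAdmissible P 𝓗 N Z ∧ ∀ t ω, Z t ω = meanFieldStep P B C N Z t ω := by
  set Y : ℕ → ℝ≥0 → Ω → E := fun n => (meanFieldStep P B C N)^[n] N with hY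
  have hYs : ∀ n, Y (n + 1) = meanFieldStep P B C N (Y n) := fun n =>
    Function.iterate_succ_apply' _ _ _
  have hYa : ∀ n, IsAdmissible P 𝓗 N (Y n) := by
    intro n
    induction n with
    | zero => exact hN.isAdmissible
    | succ n ih => rw [hYs]; exact ih.meanFieldStep hN hB hC
  have hbound : ∀ T : ℝ≥0, ∃ a : Ω → ℝ, MemLp a 2 P ∧ (∀ ω, 0 ≤ a ω) ∧
      (∀ ω, ∫ ω', a ω' ∂P ≤ 2 * a ω) ∧ ∀ n, ∀ t ≤ T, ∀ ω,
        ‖Y n t ω - Y (n + 1) t ω‖ ≤ (1 / 2) ^ n * Real.exp ((6 * L + 1) * t) * a ω := by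
    intro T
    obtain ⟨a, ha, hb⟩ := (hYa 1).bound T
    have haI : Integrable (fun ω => |a ω|) P := (ha.integrable one_le_two).abs
    have hint0 : 0 ≤ ∫ ω, |a ω| ∂P := integral_nonneg fun _ => abs_nonneg _
    have hA0 : ∀ ω, 0 ≤ |a ω| + ∫ ω', |a ω'| ∂P := fun ω => by positivity
    -- Adding the constant 𝔼|a| to |a| produces an envelope with mean 2𝔼|a|, at most twice its value
    -- at every ω. This is the condition that the contraction estimate needs.
    have hA2 : ∀ ω, ∫ ω', (|a ω'| + ∫ ω'', |a ω''| ∂P) ∂P ≤ 2 * (|a ω| + ∫ ω', |a ω'| ∂P) := by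
      intro ω
      rw [integral_add haI (integrable_const _)]
      simp only [integral_const, probReal_univ, one_smul]
      linarith [abs_nonneg (a ω)]
    have hAm : MemLp (fun ω => |a ω| + ∫ ω', |a ω'| ∂P) 2 P := ha.abs.add (memLp_const _)
    refine ⟨fun ω => |a ω| + ∫ ω', |a ω'| ∂P, hAm, hA0, hA2, fun n => ?_⟩
    induction n with
    | zero =>
      intro t ht ω
      rw [norm_sub_rev, pow_zero, one_mul]
      refine ((hb t ht ω).trans (le_abs_self _)).trans ?_
      have h1 : 1 ≤ Real.exp ((6 * L + 1) * t) := Real.one_le_exp (by positivity)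
      nlinarith [abs_nonneg (a ω), hA0 ω]
    | succ n ih =>
      intro t ht ω
      have := norm_meanFieldStep_sub_le hN (hYa n) (hYa (n + 1)) hB hC
        (hAm.integrable one_le_two) hA0 hA2 (by positivity) ih t ht ω
      rw [← hYs, ← hYs] at this
      rwa [pow_succ, ← div_eq_mul_one_div]
  -- The geometric bound holds at every ω, so the limit exists everywhere and is adapted to the same
  -- filtration as the iterates, with no exceptional set.
  have hlim : ∀ t ω, ∃ z, Filter.Tendsto (fun n => Y n t ω) Filter.atTop (nhds z) := by
    intro t ω
    obtain ⟨a, -, -, -, hb⟩ := hbound t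
    refine cauchySeq_tendsto_of_complete (cauchySeq_of_le_geometric (1 / 2)
      (Real.exp ((6 * L + 1) * t) * a ω) (by norm_num) fun n => ?_)
    rw [dist_eq_norm]
    exact (hb n t le_rfl ω).trans (le_of_eq (by ring))
  choose Z hZ using hlim
  have hYZ : ∀ T : ℝ≥0, ∃ a : Ω → ℝ, MemLp a 2 P ∧ (∀ ω, 0 ≤ a ω) ∧
      (∀ ω, ∫ ω', a ω' ∂P ≤ 2 * a ω) ∧ ∀ n, ∀ t ≤ T, ∀ ω,
        ‖Y n t ω - Z t ω‖ ≤ 2 * (1 / 2) ^ n * Real.exp ((6 * L + 1) * t) * a ω := by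
    intro T
    obtain ⟨a, ha, ha0, ha2, hb⟩ := hbound T
    refine ⟨a, ha, ha0, ha2, fun n t ht ω => ?_⟩
    rw [← dist_eq_norm]
    refine (dist_le_of_le_geometric_of_tendsto (1 / 2) (Real.exp ((6 * L + 1) * t) * a ω)
      (by norm_num) (fun n => ?_) (hZ t ω) n).trans (le_of_eq (by ring))
    rw [dist_eq_norm]
    exact (hb n t ht ω).trans (le_of_eq (by ring))
  have hZa : IsAdmissible P 𝓗 N Z := by
    refine ⟨fun t => ?_, fun ω => ?_, fun T => ?_⟩
    · exact stronglyMeasurable_of_tendsto Filter.atTop (fun n => (hYa n).adapted t)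
        (tendsto_pi_nhds.2 fun ω => hZ t ω)
    · refine TendstoLocallyUniformly.continuous (F := fun n t => Y n t ω) (p := Filter.atTop) ?_
        (Filter.Eventually.of_forall fun n => (hYa n).cont ω).frequently
      rw [Metric.tendstoLocallyUniformly_iff]
      intro ε hε x
      obtain ⟨a, -, ha0, -, hb⟩ := hYZ (x + 1)
      refine ⟨Set.Iic (x + 1), Iic_mem_nhds (lt_add_one x), ?_⟩
      have h0 : Filter.Tendsto
          (fun n : ℕ => 2 * (1 / 2 : ℝ) ^ n * Real.exp ((6 * L + 1) * (x + 1 : ℝ≥0)) * a ω)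
          Filter.atTop (nhds 0) := by
        have := (tendsto_pow_atTop_nhds_zero_of_lt_one (r := (1 / 2 : ℝ)) (by norm_num)
          (by norm_num)).const_mul 2
        simpa using (this.mul_const (Real.exp ((6 * L + 1) * (x + 1 : ℝ≥0)))).mul_const (a ω)
      filter_upwards [h0.eventually (gt_mem_nhds hε)] with n hn y hy
      rw [dist_comm, dist_eq_norm]
      refine lt_of_le_of_lt ((hb n y hy ω).trans ?_) hn
      have hy' : (y : ℝ) ≤ (x + 1 : ℝ≥0) := NNReal.coe_le_coe.2 hy
      have := ha0 ω
      gcongr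
    -- `Y 0` is the driver, so the error estimate at n = 0 is the required envelope for `Z`.
    · obtain ⟨a, ha, ha0, -, hb⟩ := hYZ T
      refine ⟨fun ω => 2 * Real.exp ((6 * L + 1) * T) * a ω, ha.const_mul _, fun t ht ω => ?_⟩
      rw [norm_sub_rev]
      refine (hb 0 t ht ω).trans ?_
      have ht' : (t : ℝ) ≤ T := NNReal.coe_le_coe.2 ht
      have := ha0 ω
      simp only [pow_zero, mul_one]
      gcongr
  refine ⟨Z, hZa, fun t ω => ?_⟩
  obtain ⟨a, ha, ha0, ha2, hb⟩ := hYZ t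
  -- Contracting the distance from `Y n` to `Z` shows that `Y (n + 1)` also converges to the step of
  -- `Z`; uniqueness of limits gives the fixed point.
  have hstep : ∀ n, ‖Y (n + 1) t ω - meanFieldStep P B C N Z t ω‖
      ≤ (1 / 2) ^ n * (Real.exp ((6 * L + 1) * t) * a ω) := fun n => by
    have := norm_meanFieldStep_sub_le hN (hYa n) hZa hB hC (ha.integrable one_le_two) ha0 ha2
      (by positivity) (hb n) t le_rfl ω
    rw [← hYs] at this
    exact this.trans (le_of_eq (by ring))
  have h0 : Filter.Tendsto (fun n : ℕ => (1 / 2 : ℝ) ^ n * (Real.exp ((6 * L + 1) * t) * a ω))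
      Filter.atTop (nhds 0) := by
    simpa using (tendsto_pow_atTop_nhds_zero_of_lt_one (r := (1 / 2 : ℝ)) (by norm_num)
      (by norm_num)).mul_const (Real.exp ((6 * L + 1) * t) * a ω)
  have hl := tendsto_iff_norm_sub_tendsto_zero.2
    (squeeze_zero (fun n => norm_nonneg _) hstep h0)
  exact tendsto_nhds_unique ((Filter.tendsto_add_atTop_iff_nat 1).2 (hZ t ω)) hl

end MeanField

/-! ### Square integrable drivers -/

section Driver

variable {Ω : Type*} {mΩ : MeasurableSpace Ω} {P : Measure Ω} {E : Type*} [NormedAddCommGroup E]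

/-- Cauchy–Schwarz in time bounds the squared path integral by T ∫ ‖V‖², and Fubini reduces its
expectation to the uniform second moment bound. -/
theorem memLp_two_integral_norm_path [IsProbabilityMeasure P] {V : ℝ≥0 → Ω → E} {T : ℝ≥0} {c : ℝ}
    (hm : ∀ t, StronglyMeasurable (V t)) (hc : ∀ ω, Continuous fun t => V t ω)
    (hV : ∀ t, MemLp (V t) 2 P) (hb : ∀ t ≤ T, ∫ ω, ‖V t ω‖ ^ 2 ∂P ≤ c) :
    MemLp (fun ω => ∫ s in (0 : ℝ)..T, ‖V s.toNNReal ω‖) 2 P := by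
  have hcR : ∀ ω, Continuous fun s : ℝ => ‖V s.toNNReal ω‖ := fun ω =>
    ((hc ω).comp continuous_real_toNNReal).norm
  have hjoint : StronglyMeasurable fun p : ℝ × Ω => ‖V p.1.toNNReal p.2‖ ^ 2 :=
    ((stronglyMeasurable_uncurry_of_continuous_of_stronglyMeasurable hc hm).comp_measurable
      ((measurable_real_toNNReal.comp measurable_fst).prodMk measurable_snd)).norm.pow 2
  have hint : Integrable (fun p : ℝ × Ω => ‖V p.1.toNNReal p.2‖ ^ 2)
      ((volume.restrict (Set.Ioc 0 (T : ℝ))).prod P) := by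
    rw [integrable_prod_iff hjoint.aestronglyMeasurable]
    refine ⟨Filter.Eventually.of_forall fun s => (hV s.toNNReal).integrable_norm_pow two_ne_zero, ?_⟩
    refine (integrable_const c).mono'
      hjoint.norm.integral_prod_right'.aestronglyMeasurable ?_
    filter_upwards [ae_restrict_mem measurableSet_Ioc] with s hs
    rw [Real.norm_of_nonneg (integral_nonneg fun _ => norm_nonneg _)]
    simpa using hb s.toNNReal (Real.toNNReal_le_iff_le_coe.2 hs.2)
  have hsq : Integrable (fun ω => ∫ s in (0 : ℝ)..T, ‖V s.toNNReal ω‖ ^ 2) P := by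
    simpa only [intervalIntegral.integral_of_le T.coe_nonneg] using hint.integral_prod_right
  have hmeas : StronglyMeasurable fun ω => ∫ s in (0 : ℝ)..T, ‖V s.toNNReal ω‖ :=
    stronglyMeasurable_integral_path (Y := fun t ω => ‖V t ω‖) (fun s _ => (hm s).norm)
      fun ω => (hc ω).norm
  rw [memLp_two_iff_integrable_sq hmeas.aestronglyMeasurable]
  refine (hsq.const_mul (T : ℝ)).mono' (hmeas.pow 2).aestronglyMeasurable
    (Filter.Eventually.of_forall fun ω => ?_)
  rw [Real.norm_of_nonneg (sq_nonneg _)]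
  exact sq_integral_le_mul_integral_sq T.coe_nonneg (hcR ω).continuousOn

theorem IsDriver.of_sq_norm_bdd [IsProbabilityMeasure P] {𝓗 : Filtration ℝ≥0 mΩ} {N : ℝ≥0 → Ω → E}
    (hN : ∀ t, StronglyMeasurable[𝓗 t] (N t)) (hc : ∀ ω, Continuous fun t => N t ω)
    (hL : ∀ t, MemLp (N t) 2 P) (hb : ∀ T : ℝ≥0, ∃ c : ℝ, ∀ t ≤ T, ∫ ω, ‖N t ω‖ ^ 2 ∂P ≤ c) :
    IsDriver P 𝓗 N where
  adapted := hN
  cont := hc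
  memLp := hL
  bdd T := by
    obtain ⟨c, hc⟩ := hb T
    refine ⟨1 + c, fun t ht => ?_⟩
    have hsq : Integrable (fun ω => ‖N t ω‖ ^ 2) P := (hL t).integrable_norm_pow two_ne_zero
    calc ∫ ω, ‖N t ω‖ ∂P ≤ ∫ ω, (1 + ‖N t ω‖ ^ 2) ∂P :=
          integral_mono ((hL t).integrable one_le_two).norm ((integrable_const _).add hsq)
            fun ω => by nlinarith [sq_nonneg (‖N t ω‖ - 1)]
      _ = 1 + ∫ ω, ‖N t ω‖ ^ 2 ∂P := by
          rw [integral_add (integrable_const _) hsq]; simp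
      _ ≤ 1 + c := by gcongr; exact hc t ht
  path T := by
    obtain ⟨c, hb⟩ := hb T
    exact memLp_two_integral_norm_path (fun t => (hN t).mono (𝓗.le t)) hc hL hb

theorem memLp_two_iff_lintegral_enorm_sq {f : Ω → E} (hf : AEStronglyMeasurable f P) :
    MemLp f 2 P ↔ ∫⁻ ω, ‖f ω‖ₑ ^ 2 ∂P < ∞ := by
  rw [MemLp, and_iff_right hf,
    eLpNorm_lt_top_iff_lintegral_rpow_enorm_lt_top two_ne_zero ENNReal.ofNat_ne_top]
  simp

theorem isP2_map_prodMk [IsProbabilityMeasure P] {d : ℕ} {X U : Ω → Vec d} (hX : MemLp X 2 P)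
    (hU : MemLp U 2 P) : IsP2 (P.map fun ω => (X ω, U ω)) := by
  have hm : AEMeasurable (fun ω => (X ω, U ω)) P := hX.1.aemeasurable.prodMk hU.1.aemeasurable
  refine ⟨Measure.isProbabilityMeasure_map hm, ?_⟩
  rw [lintegral_map' (by fun_prop) hm, lintegral_add_left' (by simpa using hX.1.enorm.pow_const 2)]
  exact ENNReal.add_lt_top.2 ⟨(memLp_two_iff_lintegral_enorm_sq hX.1).1 hX,
    (memLp_two_iff_lintegral_enorm_sq hU.1).1 hU⟩

theorem IsP2.memLp_of_map_eq {d : ℕ} {q : Measure (Vec d × Vec d)} (hq : IsP2 q)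
    {ξ : Ω → Vec d × Vec d} (hξ : Measurable ξ) (hmap : P.map ξ = q) :
    MemLp ξ 2 P := by
  have h := hq.2
  rw [← hmap, lintegral_map (by fun_prop) hξ] at h
  refine (memLp_two_iff_lintegral_enorm_sq hξ.aestronglyMeasurable).2
    (lt_of_le_of_lt (lintegral_mono fun ω => ?_) h)
  have hmax : ‖ξ ω‖ₑ = max ‖(ξ ω).1‖ₑ ‖(ξ ω).2‖ₑ := by
    simp only [enorm_eq_nnnorm, Prod.nnnorm_def, ENNReal.coe_max]
  rw [hmax]
  rcases le_total ‖(ξ ω).1‖ₑ ‖(ξ ω).2‖ₑ with h | h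
  · rw [max_eq_right h]; exact le_add_self
  · rw [max_eq_left h]; exact le_self_add

end Driver

/-! ### The system as one equation -/

section System

/-- The state space of `(θ, m, X, U)`. -/
abbrev State (dθ dx : ℕ) : Type := Vec dθ × Vec dθ × Vec dx × Vec dx

variable {dθ dx : ℕ}

/-- The part of the drift that depends only on the current state. -/
noncomputable def localDrift (ℓ : Vec dθ → Vec dx → ℝ) (ηθ γθ ηx γx : ℝ) (z : State dθ dx) :
    State dθ dx :=
  (ηθ • z.2.1, -((γθ * ηθ) • z.2.1), ηx • z.2.2.2,
    gradX ℓ z.1 z.2.2.1 - (γx * ηx) • z.2.2.2)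

/-- The inclusion of the momentum component. -/
noncomputable def momentumInclusion (dθ dx : ℕ) : Vec dθ →L[ℝ] State dθ dx :=
  ContinuousLinearMap.inr ℝ (Vec dθ) (Vec dθ × Vec dx × Vec dx) ∘L
    ContinuousLinearMap.inl ℝ (Vec dθ) (Vec dx × Vec dx)

theorem momentumInclusion_apply (v : Vec dθ) : momentumInclusion dθ dx v = (0, v, 0, 0) := rfl

theorem norm_momentumInclusion (v : Vec dθ) : ‖momentumInclusion dθ dx v‖ = ‖v‖ := by
  simp [momentumInclusion_apply, Prod.norm_def]

/-- The part of the drift that enters through its expectation. -/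
noncomputable def meanDrift (ℓ : Vec dθ → Vec dx → ℝ) (z : State dθ dx) : State dθ dx :=
  momentumInclusion dθ dx (gradTheta ℓ z.1 z.2.2.1)

theorem HasLipschitzGradient.exists_lipschitzWith_drift {ℓ : Vec dθ → Vec dx → ℝ} {K : ℝ}
    (h : HasLipschitzGradient ℓ K) (ηθ γθ ηx γx : ℝ) :
    ∃ L : ℝ≥0, LipschitzWith L (localDrift ℓ ηθ γθ ηx γx) ∧ LipschitzWith L (meanDrift ℓ) ∧
      LipschitzWith L (fun p : Vec dθ × Vec dx => gradTheta ℓ p.1 p.2) := by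
  obtain ⟨L, hθ, hx⟩ := h.exists_lipschitzWith
  have h1 : LipschitzWith 1 fun z : State dθ dx => z.1 := LipschitzWith.prod_fst
  have h2 : LipschitzWith 1 fun z : State dθ dx => z.2 := LipschitzWith.prod_snd
  have h21 : LipschitzWith (1 * 1) fun z : State dθ dx => z.2.1 := LipschitzWith.prod_fst.comp h2
  have h22 : LipschitzWith (1 * 1) fun z : State dθ dx => z.2.2 := LipschitzWith.prod_snd.comp h2
  have hX : LipschitzWith (1 * (1 * 1)) fun z : State dθ dx => z.2.2.1 :=
    LipschitzWith.prod_fst.comp h22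
  have hU : LipschitzWith (1 * (1 * 1)) fun z : State dθ dx => z.2.2.2 :=
    LipschitzWith.prod_snd.comp h22
  have hg := hθ.comp (h1.prodMk hX)
  have hb1 := (lipschitzWith_smul ηθ).comp h21
  have hb2 := ((lipschitzWith_smul (γθ * ηθ)).comp h21).neg
  have hb3 := (lipschitzWith_smul ηx).comp hU
  have hb4 := (hx.comp (h1.prodMk hX)).sub ((lipschitzWith_smul (γx * ηx)).comp hU)
  obtain ⟨LB, hB⟩ : ∃ LB, LipschitzWith LB (localDrift ℓ ηθ γθ ηx γx) :=
    ⟨_, hb1.prodMk (hb2.prodMk (hb3.prodMk hb4))⟩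
  obtain ⟨LC, hC⟩ : ∃ LC, LipschitzWith LC (meanDrift ℓ : State dθ dx → State dθ dx) :=
    ⟨_, (momentumInclusion dθ dx).lipschitz.comp hg⟩
  exact ⟨max (max LB LC) L, hB.weaken ((le_max_left _ _).trans (le_max_left _ _)),
    hC.weaken ((le_max_right _ _).trans (le_max_left _ _)), hθ.weaken (le_max_right _ _)⟩

theorem intervalIntegral_state {F : ℝ → State dθ dx} {t : ℝ} (hF : IntervalIntegrable F volume 0 t) :
    ∫ s in (0 : ℝ)..t, F s = (∫ s in (0 : ℝ)..t, (F s).1, ∫ s in (0 : ℝ)..t, (F s).2.1,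
      ∫ s in (0 : ℝ)..t, (F s).2.2.1, ∫ s in (0 : ℝ)..t, (F s).2.2.2) := by
  let p1 := ContinuousLinearMap.fst ℝ (Vec dθ) (Vec dθ × Vec dx × Vec dx)
  let p2 := ContinuousLinearMap.snd ℝ (Vec dθ) (Vec dθ × Vec dx × Vec dx)
  let q1 := ContinuousLinearMap.fst ℝ (Vec dθ) (Vec dx × Vec dx)
  let q2 := ContinuousLinearMap.snd ℝ (Vec dθ) (Vec dx × Vec dx)
  let r1 := ContinuousLinearMap.fst ℝ (Vec dx) (Vec dx)
  let r2 := ContinuousLinearMap.snd ℝ (Vec dx) (Vec dx)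
  ext1
  · exact (p1.intervalIntegral_comp_comm hF).symm
  ext1
  · exact ((q1 ∘L p2).intervalIntegral_comp_comm hF).symm
  ext1
  · exact ((r1 ∘L q2 ∘L p2).intervalIntegral_comp_comm hF).symm
  · exact ((r2 ∘L q2 ∘L p2).intervalIntegral_comp_comm hF).symm

/-- The mean drift `c` is left arbitrary so that one splitting serves both the constructed process,
where `c` is an expectation, and a given solution, where `c` is read off one sample path. -/
theorem eq_add_integral_drift_iff {ℓ : Vec dθ → Vec dx → ℝ} {ηθ γθ ηx γx : ℝ}
    {z : ℝ → State dθ dx} {c : ℝ → Vec dθ} {t : ℝ} {p a : State dθ dx}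
    (hF : IntervalIntegrable
      (fun s => localDrift ℓ ηθ γθ ηx γx (z s) + momentumInclusion dθ dx (c s)) volume 0 t) :
    p = a + ∫ s in (0 : ℝ)..t,
        (localDrift ℓ ηθ γθ ηx γx (z s) + momentumInclusion dθ dx (c s)) ↔
      p.1 = a.1 + ∫ s in (0 : ℝ)..t, ηθ • (z s).2.1 ∧
      p.2.1 = a.2.1 + ∫ s in (0 : ℝ)..t, (c s - (γθ * ηθ) • (z s).2.1) ∧
      p.2.2.1 = a.2.2.1 + ∫ s in (0 : ℝ)..t, ηx • (z s).2.2.2 ∧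
      p.2.2.2 = a.2.2.2 + ∫ s in (0 : ℝ)..t,
        (gradX ℓ (z s).1 (z s).2.2.1 - (γx * ηx) • (z s).2.2.2) := by
  rw [intervalIntegral_state hF]
  simp only [Prod.ext_iff, localDrift, momentumInclusion_apply, Prod.fst_add, Prod.snd_add,
    add_zero, neg_add_eq_sub]

/-- The parameters are determined by the mean-field drift, even if that drift depends on them
in a Lipschitz way. -/
theorem parameters_unique {ηθ κ L t : ℝ} (hL : 0 ≤ L) (ht : 0 ≤ t) {θ₀ m₀ : Vec dθ}
    {θ m c θ' m' c' : ℝ → Vec dθ}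
    (hθ : ContinuousOn θ (Set.Icc 0 t)) (hm : ContinuousOn m (Set.Icc 0 t))
    (hθ' : ContinuousOn θ' (Set.Icc 0 t)) (hm' : ContinuousOn m' (Set.Icc 0 t))
    (hc : IntervalIntegrable c volume 0 t) (hc' : IntervalIntegrable c' volume 0 t)
    (eθ : ∀ s ∈ Set.Icc 0 t, θ s = θ₀ + ∫ r in (0 : ℝ)..s, ηθ • m r)
    (em : ∀ s ∈ Set.Icc 0 t, m s = m₀ + ∫ r in (0 : ℝ)..s, (c r - κ • m r))
    (eθ' : ∀ s ∈ Set.Icc 0 t, θ' s = θ₀ + ∫ r in (0 : ℝ)..s, ηθ • m' r)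
    (em' : ∀ s ∈ Set.Icc 0 t, m' s = m₀ + ∫ r in (0 : ℝ)..s, (c' r - κ • m' r))
    (hcc : ∀ s ∈ Set.Icc 0 t, ‖c s - c' s‖ ≤ L * ‖θ s - θ' s‖) :
    θ t = θ' t ∧ m t = m' t := by
  have hint : ∀ {c m : ℝ → Vec dθ}, IntervalIntegrable c volume 0 t →
      ContinuousOn m (Set.Icc 0 t) → (IntervalIntegrable (fun r => ηθ • m r) volume 0 t ∧
        IntervalIntegrable (fun r => c r - κ • m r) volume 0 t) := by
    intro c m hc hm
    rw [← Set.uIcc_of_le ht] at hm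
    exact ⟨(hm.const_smul ηθ).intervalIntegrable, hc.sub (hm.const_smul κ).intervalIntegrable⟩
  have hpair : ∀ {c m : ℝ → Vec dθ}, IntervalIntegrable c volume 0 t →
      ContinuousOn m (Set.Icc 0 t) →
        IntervalIntegrable (fun r => (ηθ • m r, c r - κ • m r)) volume 0 t := fun hc hm =>
    ⟨(hint hc hm).1.1.prodMk (hint hc hm).2.1, (hint hc hm).1.2.prodMk (hint hc hm).2.2⟩
  have hsplit : ∀ {c m : ℝ → Vec dθ}, IntervalIntegrable c volume 0 t →
      ContinuousOn m (Set.Icc 0 t) → ∀ s ∈ Set.Icc 0 t,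
        ∫ r in (0 : ℝ)..s, (ηθ • m r, c r - κ • m r)
          = (∫ r in (0 : ℝ)..s, ηθ • m r, ∫ r in (0 : ℝ)..s, (c r - κ • m r)) := by
    intro c m hc hm s hs
    have h := (hpair hc hm).mono_set (c := 0) (d := s) (by
      rw [Set.uIcc_of_le ht, Set.uIcc_of_le hs.1]; exact Set.Icc_subset_Icc_right hs.2)
    ext1
    · exact ((ContinuousLinearMap.fst ℝ (Vec dθ) (Vec dθ)).intervalIntegral_comp_comm h).symm
    · exact ((ContinuousLinearMap.snd ℝ (Vec dθ) (Vec dθ)).intervalIntegral_comp_comm h).symm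
  -- Grönwall for the pair in the sup norm, without forcing. The rate of the first component is
  -- bounded by |ηθ| and that of the second by L + |κ|; their sum dominates the maximum.
  have key := norm_sub_le_exp_mul_integral (f := fun s => (θ s, m s)) (g := fun s => (θ' s, m' s))
    (F := fun r => (ηθ • m r, c r - κ • m r)) (G := fun r => (ηθ • m' r, c' r - κ • m' r))
    (k := fun _ => 0) (L := |ηθ| + (L + |κ|)) (by positivity) ht (hθ.prodMk hm) (hθ'.prodMk hm')
    (hpair hc hm) (hpair hc' hm') intervalIntegrable_const (fun _ _ => le_rfl)
    (fun s hs => by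
      rw [hsplit hc hm s hs, hsplit hc' hm' s hs]
      ext1 <;> simp [eθ s hs, em s hs, eθ' s hs, em' s hs])
    (fun s hs => by
      have h1 : ‖θ s - θ' s‖ ≤ ‖((θ s, m s) : Vec dθ × Vec dθ) - (θ' s, m' s)‖ :=
        norm_fst_le ((θ s, m s) - (θ' s, m' s) : Vec dθ × Vec dθ)
      have h2 : ‖m s - m' s‖ ≤ ‖((θ s, m s) : Vec dθ × Vec dθ) - (θ' s, m' s)‖ :=
        norm_snd_le ((θ s, m s) - (θ' s, m' s) : Vec dθ × Vec dθ)
      set D := ‖((θ s, m s) : Vec dθ × Vec dθ) - (θ' s, m' s)‖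
      have hD : 0 ≤ D := norm_nonneg _
      have hκ := mul_le_mul_of_nonneg_left h2 (abs_nonneg κ)
      have hη := mul_le_mul_of_nonneg_left h2 (abs_nonneg ηθ)
      have hLD := mul_le_mul_of_nonneg_left h1 hL
      have hL0 := mul_nonneg hL hD
      have hη0 := mul_nonneg (abs_nonneg ηθ) hD
      have hκ0 := mul_nonneg (abs_nonneg κ) hD
      rw [Prod.mk_sub_mk, Prod.norm_def, add_zero]
      refine max_le ?_ ?_
      · simp only
        rw [← smul_sub, norm_smul, Real.norm_eq_abs]
        linarith
      · simp only
        have : c s - κ • m s - (c' s - κ • m' s) = (c s - c' s) - κ • (m s - m' s) := by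
          rw [smul_sub]; abel
        rw [this]
        refine (norm_sub_le _ _).trans ?_
        rw [norm_smul, Real.norm_eq_abs]
        linarith [hcc s hs])
  simp only [intervalIntegral.integral_zero, mul_zero, norm_le_zero_iff, sub_eq_zero,
    Prod.mk.injEq] at key
  exact key

end System

/-! ### Pathwise comparison and uniqueness -/

section Uniqueness

variable {Ω : Type*} {mΩ : MeasurableSpace Ω} {P : Measure Ω} {dθ dx : ℕ}
  {ℓ : Vec dθ → Vec dx → ℝ} {ηθ γθ ηx γx : ℝ} {θ₀ m₀ : Vec dθ}
  {ξ : Ω → Vec dx × Vec dx} {W : ℝ≥0 → Ω → Vec dx} {T : ℝ≥0∞}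

theorem mem_times_of_le {s t : ℝ≥0} (ht : t ∈ times T) (hst : s ≤ t) : s ∈ times T :=
  (ENNReal.coe_le_coe.2 hst).trans ht

theorem toNNReal_mem_times {t : ℝ≥0} (ht : t ∈ times T) {s : ℝ} (hs : s ∈ Set.Icc (0 : ℝ) t) :
    s.toNNReal ∈ times T :=
  mem_times_of_le ht (Real.toNNReal_le_iff_le_coe.2 hs.2)

theorem continuousOn_comp_toNNReal {F : Type*} [TopologicalSpace F] {f : ℝ≥0 → F}
    (hf : ContinuousOn f (times T)) {t : ℝ≥0} (ht : t ∈ times T) :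
    ContinuousOn (fun s : ℝ => f s.toNNReal) (Set.Icc 0 t) :=
  hf.comp continuous_real_toNNReal.continuousOn fun _ hs => toNNReal_mem_times ht hs

/-- The initial value together with the scaled noise. -/
noncomputable def noise (γx : ℝ) (θ₀ m₀ : Vec dθ) (ξ : Ω → Vec dx × Vec dx)
    (W : ℝ≥0 → Ω → Vec dx) (t : ℝ≥0) (ω : Ω) : State dθ dx :=
  (θ₀, m₀, (ξ ω).1, (ξ ω).2 + √(2 * γx) • W t ω)

/-- A path solving the integral equation with mean-field drift `c` and additive term `w`. -/
structure SolvesPath (ℓ : Vec dθ → Vec dx → ℝ) (ηθ γθ ηx γx : ℝ) (T : ℝ≥0∞)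
    (w : ℝ≥0 → State dθ dx) (c : ℝ → Vec dθ) (z : ℝ≥0 → State dθ dx) : Prop where
  cont : ContinuousOn z (times T)
  integrable : ∀ t ∈ times T, IntervalIntegrable c volume 0 t
  eq : ∀ t ∈ times T, z t = w t + ∫ s in (0 : ℝ)..t,
    (localDrift ℓ ηθ γθ ηx γx (z s.toNNReal) + momentumInclusion dθ dx (c s))

theorem intervalIntegrable_localDrift_add {L : ℝ≥0}
    (hB : LipschitzWith L (localDrift ℓ ηθ γθ ηx γx)) {z : ℝ≥0 → State dθ dx} {c : ℝ → Vec dθ}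
    {t : ℝ≥0} (ht : t ∈ times T) (hz : ContinuousOn z (times T))
    (hc : IntervalIntegrable c volume 0 t) :
    IntervalIntegrable (fun s : ℝ => localDrift ℓ ηθ γθ ηx γx (z s.toNNReal)
      + momentumInclusion dθ dx (c s)) volume 0 t := by
  refine IntervalIntegrable.add (ContinuousOn.intervalIntegrable ?_)
    ⟨(momentumInclusion dθ dx).integrable_comp hc.1, (momentumInclusion dθ dx).integrable_comp hc.2⟩
  rw [Set.uIcc_of_le t.coe_nonneg]
  exact hB.continuous.comp_continuousOn (continuousOn_comp_toNNReal hz ht)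

theorem SolvesPath.eq_iff {L : ℝ≥0} (hB : LipschitzWith L (localDrift ℓ ηθ γθ ηx γx))
    {z : ℝ≥0 → State dθ dx} {c : ℝ → Vec dθ} {t : ℝ≥0} (ht : t ∈ times T)
    (hz : ContinuousOn z (times T)) (hc : IntervalIntegrable c volume 0 t) {p a : State dθ dx} :
    p = a + ∫ s in (0 : ℝ)..t,
        (localDrift ℓ ηθ γθ ηx γx (z s.toNNReal) + momentumInclusion dθ dx (c s)) ↔
      p.1 = a.1 + ∫ s in (0 : ℝ)..t, ηθ • (z s.toNNReal).2.1 ∧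
      p.2.1 = a.2.1 + ∫ s in (0 : ℝ)..t, (c s - (γθ * ηθ) • (z s.toNNReal).2.1) ∧
      p.2.2.1 = a.2.2.1 + ∫ s in (0 : ℝ)..t, ηx • (z s.toNNReal).2.2.2 ∧
      p.2.2.2 = a.2.2.2 + ∫ s in (0 : ℝ)..t,
        (gradX ℓ (z s.toNNReal).1 (z s.toNNReal).2.2.1 - (γx * ηx) • (z s.toNNReal).2.2.2) :=
  eq_add_integral_drift_iff (z := fun s : ℝ => z s.toNNReal)
    (intervalIntegrable_localDrift_add hB ht hz hc)

/-- Two paths with the same additive term differ at most by the accumulated difference of their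
mean-field drifts. -/
theorem SolvesPath.norm_sub_le {L : ℝ≥0} (hB : LipschitzWith L (localDrift ℓ ηθ γθ ηx γx))
    {w z z' : ℝ≥0 → State dθ dx} {c c' : ℝ → Vec dθ}
    (h : SolvesPath ℓ ηθ γθ ηx γx T w c z) (h' : SolvesPath ℓ ηθ γθ ηx γx T w c' z')
    {t : ℝ≥0} (ht : t ∈ times T) :
    ‖z t - z' t‖ ≤ Real.exp (L * t) * ∫ s in (0 : ℝ)..t, ‖c s - c' s‖ := by
  have hc := h.integrable t ht
  have hc' := h'.integrable t ht
  have key := norm_sub_le_exp_mul_integral (f := fun s : ℝ => z s.toNNReal)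
    (g := fun s : ℝ => z' s.toNNReal) (k := fun s => ‖c s - c' s‖) L.coe_nonneg t.coe_nonneg
    (continuousOn_comp_toNNReal h.cont ht) (continuousOn_comp_toNNReal h'.cont ht)
    (intervalIntegrable_localDrift_add hB ht h.cont hc)
    (intervalIntegrable_localDrift_add hB ht h'.cont hc')
    (hc.sub hc').norm (fun _ _ => norm_nonneg _)
    (fun s hs => by
      have hs' := toNNReal_mem_times ht hs
      have e := h.eq _ hs'
      have e' := h'.eq _ hs'
      rw [Real.coe_toNNReal _ hs.1] at e e'
      rw [e, e', add_sub_add_left_eq_sub])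
    (fun s _ => by
      rw [add_sub_add_comm, ← map_sub]
      refine (norm_add_le _ _).trans ?_
      rw [norm_momentumInclusion]
      gcongr
      exact hB.norm_sub_le _ _)
  simpa only [Real.toNNReal_coe] using key

variable {𝓖 𝓖' : ℝ≥0 → MeasurableSpace Ω} {θ m θ' m' : ℝ≥0 → Ω → Vec dθ}
  {X U X' U' : ℝ≥0 → Ω → Vec dx}

/-- Both integrals use the same measure, so only the parameters differ. Taking μ to be the law of
X_t, which does not depend on ω, makes all sample paths of (θ, m) solve one Lipschitz equation. -/
theorem norm_integral_gradTheta_sub_le {L : ℝ≥0}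
    (hL : LipschitzWith L fun p : Vec dθ × Vec dx => gradTheta ℓ p.1 p.2)
    {μ : Measure (Vec dx)} [IsProbabilityMeasure μ] {θ₁ θ₂ : Vec dθ}
    (h₁ : Integrable (fun x => gradTheta ℓ θ₁ x) μ)
    (h₂ : Integrable (fun x => gradTheta ℓ θ₂ x) μ) :
    ‖(∫ x, gradTheta ℓ θ₁ x ∂μ) - ∫ x, gradTheta ℓ θ₂ x ∂μ‖ ≤ L * ‖θ₁ - θ₂‖ := by
  rw [← integral_sub h₁ h₂]
  refine (norm_integral_le_of_norm_le_const (C := L * ‖θ₁ - θ₂‖)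
    (Filter.Eventually.of_forall fun x => ?_)).trans (by simp)
  simpa [Prod.norm_def] using hL.norm_sub_le (θ₁, x) (θ₂, x)

/-- The mean-field drift of a solution is a deterministic function of time. -/
theorem IsSolution.exists_meanDrift [IsProbabilityMeasure P] {L : ℝ≥0}
    (hB : LipschitzWith L (localDrift ℓ ηθ γθ ηx γx))
    (hL : LipschitzWith L fun p : Vec dθ × Vec dx => gradTheta ℓ p.1 p.2)
    (h𝓖 : ∀ t, 𝓖 t ≤ mΩ) (h : IsSolution P ℓ ηθ γθ ηx γx θ₀ m₀ ξ W T 𝓖 θ m X U) :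
    ∃ c : ℝ → Vec dθ,
      (∀ᵐ ω ∂P, SolvesPath ℓ ηθ γθ ηx γx T (fun t => noise γx θ₀ m₀ ξ W t ω) c
        (fun t => (θ t ω, m t ω, X t ω, U t ω))) ∧
      ∀ t ∈ times T, Integrable (fun ω => gradTheta ℓ (θ t ω) (X t ω)) P ∧
        c t = ∫ ω, gradTheta ℓ (θ t ω) (X t ω) ∂P := by
  have hXm : ∀ t ∈ times T, AEMeasurable (X t) P := fun t ht =>
    ((h.adapted_X t ht).mono (h𝓖 t)).aemeasurable
  have hgood := h.cont_θ.and <| h.cont_m.and <| h.cont_X.and <| h.cont_U.and <|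
    h.integrable_space.and <| h.integrable_time.and <| h.eq_θ.and <| h.eq_m.and <| h.eq_X.and h.eq_U
  -- One sample point with all the almost sure properties serves as reference. Almost every other
  -- path of θ agrees with it, so the mean drift may be frozen along ω₀.
  obtain ⟨ω₀, hθ₀, hm₀, -, -, hs₀, ht₀, eθ₀, em₀, -, -⟩ := hgood.exists
  have hpar : ∀ᵐ ω ∂P, ∀ t ∈ times T, θ t ω = θ t ω₀ := by
    filter_upwards [hgood] with ω hω t ht
    obtain ⟨hθ, hm, -, -, hs, hti, eθ, em, -, -⟩ := hω
    have key := parameters_unique (ηθ := ηθ) (κ := γθ * ηθ) (L := L) L.coe_nonneg t.coe_nonneg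
      (θ₀ := θ₀) (m₀ := m₀)
      (continuousOn_comp_toNNReal hθ ht) (continuousOn_comp_toNNReal hm ht)
      (continuousOn_comp_toNNReal hθ₀ ht) (continuousOn_comp_toNNReal hm₀ ht)
      (hti t ht) (ht₀ t ht)
      (fun s hs => by
        have := eθ _ (toNNReal_mem_times ht hs); rwa [Real.coe_toNNReal _ hs.1] at this)
      (fun s hs => by
        have := em _ (toNNReal_mem_times ht hs); rwa [Real.coe_toNNReal _ hs.1] at this)
      (fun s hs => by
        have := eθ₀ _ (toNNReal_mem_times ht hs); rwa [Real.coe_toNNReal _ hs.1] at this)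
      (fun s hs => by
        have := em₀ _ (toNNReal_mem_times ht hs); rwa [Real.coe_toNNReal _ hs.1] at this)
      (fun s hs' => by
        have hst := toNNReal_mem_times ht hs'
        have := Measure.isProbabilityMeasure_map (hXm _ hst)
        exact norm_integral_gradTheta_sub_le hL (hs _ hst) (hs₀ _ hst))
    simpa only [Real.toNNReal_coe] using key.1
  refine ⟨fun s => ∫ x, gradTheta ℓ (θ s.toNNReal ω₀) x ∂(P.map (X s.toNNReal)), ?_, fun t ht => ?_⟩
  · filter_upwards [hgood, hpar] with ω hsol hω
    obtain ⟨hθ, hm, hX, hU, -, -, eθ, em, eX, eU⟩ := hsol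
    have hz : ContinuousOn (fun t => (θ t ω, m t ω, X t ω, U t ω)) (times T) :=
      hθ.prodMk (hm.prodMk (hX.prodMk hU))
    refine ⟨hz, ht₀, fun t ht => ?_⟩
    refine (SolvesPath.eq_iff hB (z := fun t => (θ t ω, m t ω, X t ω, U t ω)) ht hz (ht₀ t ht)).2
      ⟨eθ t ht, ?_, eX t ht, ?_⟩
    · refine (em t ht).trans ?_
      simp only [noise]
      congr 1
      refine intervalIntegral.integral_congr fun s hs => ?_
      rw [Set.uIcc_of_le t.coe_nonneg] at hs
      simp only [hω _ (toNNReal_mem_times ht hs)]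
    · refine (eU t ht).trans ?_
      simp only [noise]
      exact add_right_comm _ _ _
  · have hcont : Continuous fun x => gradTheta ℓ (θ t ω₀) x :=
      hL.continuous.comp (continuous_const.prodMk continuous_id)
    have heq : (fun ω => gradTheta ℓ (θ t ω₀) (X t ω)) =ᵐ[P]
        fun ω => gradTheta ℓ (θ t ω) (X t ω) := by
      filter_upwards [hpar] with ω hω
      rw [hω t ht]
    have hint := (integrable_map_measure hcont.aestronglyMeasurable (hXm t ht)).1 (hs₀ t ht)
    refine ⟨hint.congr heq, ?_⟩
    have hmap : ∫ x, gradTheta ℓ (θ t ω₀) x ∂(P.map (X t))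
        = ∫ ω, gradTheta ℓ (θ t ω₀) (X t ω) ∂P :=
      integral_map (hXm t ht) hcont.aestronglyMeasurable
    simp only [Real.toNNReal_coe]
    exact hmap.trans (integral_congr_ae heq)

/-- Any two solutions are indistinguishable. -/
theorem IsSolution.indistinguishable [IsProbabilityMeasure P] {K : ℝ}
    (hℓ : HasLipschitzGradient ℓ K) (h𝓖 : ∀ t, 𝓖 t ≤ mΩ) (h𝓖' : ∀ t, 𝓖' t ≤ mΩ)
    (h : IsSolution P ℓ ηθ γθ ηx γx θ₀ m₀ ξ W T 𝓖 θ m X U)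
    (h' : IsSolution P ℓ ηθ γθ ηx γx θ₀ m₀ ξ W T 𝓖' θ' m' X' U') :
    ∀ᵐ ω ∂P, ∀ t ∈ times T,
      θ t ω = θ' t ω ∧ m t ω = m' t ω ∧ X t ω = X' t ω ∧ U t ω = U' t ω := by
  obtain ⟨L, hB, -, hL⟩ := hℓ.exists_lipschitzWith_drift ηθ γθ ηx γx
  obtain ⟨c, hz, hc⟩ := h.exists_meanDrift hB hL h𝓖
  obtain ⟨c', hz', hc'⟩ := h'.exists_meanDrift hB hL h𝓖'
  obtain ⟨ω₀, hω₀, hω₀'⟩ := (hz.and hz').exists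
  -- Grönwall is applied to the primitive of ‖c - c'‖, which is continuous, rather than to ‖c - c'‖
  -- itself, which is only known to be integrable in time.
  have hzero : ∀ t ∈ times T, ∫ s in (0 : ℝ)..t, ‖c s - c' s‖ = 0 := by
    intro t ht
    have hI : IntervalIntegrable (fun s => ‖c s - c' s‖) volume 0 t :=
      ((hω₀.integrable t ht).sub (hω₀'.integrable t ht)).norm
    have hgc : ContinuousOn (fun s => ∫ r in (0 : ℝ)..s, ‖c r - c' r‖) (Set.Icc 0 t) := by
      have := intervalIntegral.continuousOn_primitive_interval' hI Set.left_mem_uIcc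
      rwa [Set.uIcc_of_le t.coe_nonneg] at this
    refine eq_zero_of_le_integral (u := fun s => ∫ r in (0 : ℝ)..s, ‖c r - c' r‖)
      (L := L * Real.exp (L * t)) (by positivity) t.coe_nonneg hgc
      (intervalIntegral.integral_nonneg t.coe_nonneg fun _ _ => norm_nonneg _) fun s hs => ?_
    have hsub : Set.uIcc 0 s ⊆ Set.uIcc 0 (t : ℝ) := by
      rw [Set.uIcc_of_le hs.1, Set.uIcc_of_le t.coe_nonneg]; exact Set.Icc_subset_Icc_right hs.2
    refine intervalIntegral.integral_mono_on hs.1 (hI.mono_set hsub)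
      (ContinuousOn.intervalIntegrable ?_) fun r hr => ?_
    · refine (continuousOn_const.mul hgc).mono ?_
      rwa [← Set.uIcc_of_le t.coe_nonneg]
    · have hrt : r ∈ Set.Icc (0 : ℝ) t := ⟨hr.1, hr.2.trans hs.2⟩
      have hrT := toNNReal_mem_times ht hrt
      obtain ⟨hi, he⟩ := hc _ hrT
      obtain ⟨hi', he'⟩ := hc' _ hrT
      rw [Real.coe_toNNReal _ hr.1] at he he'
      rw [he, he', ← integral_sub hi hi', mul_assoc]
      -- The pathwise distance has a deterministic bound, so it passes under the expectation without
      -- second moments of either solution.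
      refine (norm_integral_le_of_norm_le_const (μ := P)
        (C := L * (Real.exp (L * t) * ∫ u in (0 : ℝ)..r, ‖c u - c' u‖)) ?_).trans (by simp)
      filter_upwards [hz, hz'] with ω hω hω'
      have hd := hω.norm_sub_le hB hω' hrT
      rw [Real.coe_toNNReal _ hr.1] at hd
      have hexp : Real.exp (L * r) ≤ Real.exp (L * t) := by gcongr; exact hrt.2
      have hint : 0 ≤ ∫ u in (0 : ℝ)..r, ‖c u - c' u‖ :=
        intervalIntegral.integral_nonneg hr.1 fun _ _ => norm_nonneg _
      refine (hL.norm_sub_le (θ r.toNNReal ω, X r.toNNReal ω)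
        (θ' r.toNNReal ω, X' r.toNNReal ω)).trans ?_
      gcongr
      refine le_trans ?_ (hd.trans (mul_le_mul_of_nonneg_right hexp hint))
      simp only [Prod.mk_sub_mk, Prod.norm_mk]
      exact max_le_max le_rfl ((le_max_left _ _).trans (le_max_right _ _))
  filter_upwards [hz, hz'] with ω hω hω' t ht
  have hd := hω.norm_sub_le hB hω' ht
  rw [hzero t ht, mul_zero, norm_le_zero_iff, sub_eq_zero] at hd
  simpa only [Prod.mk.injEq] using hd

end Uniqueness

/-! ### Existence of a strong solution -/

section Existence

variable {Ω : Type*} {mΩ : MeasurableSpace Ω} {P : Measure Ω} {dθ dx : ℕ}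

theorem stronglyMeasurable_noise {m : MeasurableSpace Ω} {ξ : Ω → Vec dx × Vec dx}
    {V : ℝ≥0 → Ω → Vec dx} (γx : ℝ) (θ₀ m₀ : Vec dθ) {t : ℝ≥0} (hξ : StronglyMeasurable ξ)
    (hV : StronglyMeasurable (V t)) : StronglyMeasurable (noise γx θ₀ m₀ ξ V t) := by
  have hX : StronglyMeasurable fun ω => (ξ ω).1 := continuous_fst.comp_stronglyMeasurable hξ
  have hU : StronglyMeasurable fun ω => (ξ ω).2 := continuous_snd.comp_stronglyMeasurable hξ
  have hUV : StronglyMeasurable fun ω => (ξ ω).2 + √(2 * γx) • V t ω :=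
    hU.add (hV.fun_const_smul _)
  exact stronglyMeasurable_const.prodMk (stronglyMeasurable_const.prodMk (hX.prodMk hUV))

theorem norm_noise_le (γx : ℝ) (θ₀ m₀ : Vec dθ) (ξ : Ω → Vec dx × Vec dx)
    (V : ℝ≥0 → Ω → Vec dx) (t : ℝ≥0) (ω : Ω) :
    ‖noise γx θ₀ m₀ ξ V t ω‖ ≤ (‖θ₀‖ + ‖m₀‖) + ‖ξ ω‖ + √(2 * γx) * ‖V t ω‖ := by
  have h1 := norm_fst_le (ξ ω)
  have h2 := norm_snd_le (ξ ω)
  have h3 := norm_add_le (ξ ω).2 (√(2 * γx) • V t ω)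
  rw [norm_smul, Real.norm_of_nonneg (Real.sqrt_nonneg _)] at h3
  have h4 : 0 ≤ √(2 * γx) * ‖V t ω‖ := by positivity
  have h5 := norm_nonneg θ₀
  have h6 := norm_nonneg m₀
  have h7 := norm_nonneg (ξ ω)
  simp only [noise, Prod.norm_mk]
  refine max_le ?_ (max_le ?_ (max_le ?_ ?_)) <;> linarith

theorem memLp_two_add_add [IsProbabilityMeasure P] {f g : Ω → ℝ} (hf : MemLp f 2 P)
    (hg : MemLp g 2 P) (κ a : ℝ) : MemLp (fun ω => κ + f ω + a * g ω) 2 P :=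
  ((memLp_const κ).add hf).add (hg.const_mul a)

theorem integral_sq_add_add_le [IsProbabilityMeasure P] {κ a : ℝ} {f g : Ω → ℝ}
    (hf : MemLp f 2 P) (hg : MemLp g 2 P) :
    ∫ ω, (κ + f ω + a * g ω) ^ 2 ∂P
      ≤ 3 * κ ^ 2 + 3 * (∫ ω, f ω ^ 2 ∂P) + 3 * a ^ 2 * ∫ ω, g ω ^ 2 ∂P := by
  have hI1 : Integrable (fun ω => 3 * κ ^ 2 + 3 * f ω ^ 2) P :=
    (integrable_const _).add (hf.integrable_sq.const_mul 3)
  have hI2 : Integrable (fun ω => 3 * a ^ 2 * g ω ^ 2) P := hg.integrable_sq.const_mul _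
  have hI : ∫ ω, ((3 * κ ^ 2 + 3 * f ω ^ 2) + 3 * a ^ 2 * g ω ^ 2) ∂P
      = 3 * κ ^ 2 + 3 * (∫ ω, f ω ^ 2 ∂P) + 3 * a ^ 2 * ∫ ω, g ω ^ 2 ∂P := by
    rw [integral_add hI1 hI2, integral_add (integrable_const _) (hf.integrable_sq.const_mul 3),
      integral_const_mul 3 fun ω => f ω ^ 2,
      integral_const_mul (3 * a ^ 2)]
    simp
  rw [← hI]
  refine integral_mono (memLp_two_add_add hf hg κ a).integrable_sq (hI1.add hI2) fun ω => ?_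
  simp only
  nlinarith [sq_nonneg (κ - f ω), sq_nonneg (κ - a * g ω), sq_nonneg (f ω - a * g ω)]

theorem isDriver_noise [IsProbabilityMeasure P] {𝓗 : Filtration ℝ≥0 mΩ} {ξ : Ω → Vec dx × Vec dx}
    {V : ℝ≥0 → Ω → Vec dx} (γx : ℝ) (θ₀ m₀ : Vec dθ)
    (hξ : ∀ t, StronglyMeasurable[𝓗 t] ξ) (hξ2 : MemLp ξ 2 P)
    (hV : ∀ t, StronglyMeasurable[𝓗 t] (V t)) (hc : ∀ ω, Continuous fun t => V t ω)
    (hV2 : ∀ t, MemLp (V t) 2 P) (hb : ∀ T : ℝ≥0, ∃ c : ℝ, ∀ t ≤ T, ∫ ω, ‖V t ω‖ ^ 2 ∂P ≤ c) :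
    IsDriver P 𝓗 (noise γx θ₀ m₀ ξ V) := by
  have hmeas : ∀ t, StronglyMeasurable[𝓗 t] (noise γx θ₀ m₀ ξ V t) := fun t =>
    stronglyMeasurable_noise γx θ₀ m₀ (hξ t) (hV t)
  have hdom : ∀ t, MemLp (fun ω => (‖θ₀‖ + ‖m₀‖) + ‖ξ ω‖ + √(2 * γx) * ‖V t ω‖) 2 P := fun t =>
    memLp_two_add_add hξ2.norm (hV2 t).norm _ _
  have hL2 : ∀ t, MemLp (noise γx θ₀ m₀ ξ V t) 2 P := fun t =>
    (hdom t).mono' ((hmeas t).mono (𝓗.le t)).aestronglyMeasurable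
      (Filter.Eventually.of_forall (norm_noise_le γx θ₀ m₀ ξ V t))
  refine IsDriver.of_sq_norm_bdd hmeas (fun ω => ?_) hL2 fun T => ?_
  · have hUV : Continuous fun t => (ξ ω).2 + √(2 * γx) • V t ω :=
      continuous_const.add ((continuous_const_smul _).comp (hc ω))
    exact continuous_const.prodMk (continuous_const.prodMk (continuous_const.prodMk hUV))
  · obtain ⟨c, hc⟩ := hb T
    refine ⟨3 * (‖θ₀‖ + ‖m₀‖) ^ 2 + 3 * (∫ ω, ‖ξ ω‖ ^ 2 ∂P) + 3 * √(2 * γx) ^ 2 * c,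
      fun t ht => ?_⟩
    have h1 : ∫ ω, ‖noise γx θ₀ m₀ ξ V t ω‖ ^ 2 ∂P
        ≤ ∫ ω, ((‖θ₀‖ + ‖m₀‖) + ‖ξ ω‖ + √(2 * γx) * ‖V t ω‖) ^ 2 ∂P :=
      integral_mono ((hL2 t).integrable_norm_pow two_ne_zero) (hdom t).integrable_sq
        fun ω => pow_le_pow_left₀ (norm_nonneg _) (norm_noise_le γx θ₀ m₀ ξ V t ω) 2
    refine (h1.trans (integral_sq_add_add_le hξ2.norm (hV2 t).norm)).trans ?_
    gcongr
    exact hc t ht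

variable {ℓ : Vec dθ → Vec dx → ℝ} {𝓕 : Filtration ℝ≥0 mΩ}
  {W : ℝ≥0 → Ω → Vec dx} {ξ : Ω → Vec dx × Vec dx}

theorem monotone_dataHistory (ξ : Ω → Vec dx × Vec dx) (W : ℝ≥0 → Ω → Vec dx) :
    Monotone (dataHistory ξ W) := fun _ _ hst =>
  sup_le_sup le_rfl (iSup_le fun r => le_iSup_of_le ⟨r.1, r.2.trans hst⟩ le_rfl)

theorem IsWiener.dataHistory_le (hW : IsWiener P 𝓕 W) (hξ : Measurable[𝓕 0] ξ) (t : ℝ≥0) :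
    dataHistory ξ W t ≤ 𝓕 t :=
  sup_le (hξ.comap_le.trans (𝓕.mono zero_le))
    (iSup_le fun s => (hW.adapted s).comap_le.trans (𝓕.mono s.2))

theorem measurable_dataHistory_init (ξ : Ω → Vec dx × Vec dx) (W : ℝ≥0 → Ω → Vec dx) (t : ℝ≥0) :
    Measurable[dataHistory ξ W t] ξ :=
  (comap_measurable ξ).mono le_sup_left le_rfl

theorem measurable_dataHistory_noise (ξ : Ω → Vec dx × Vec dx) (W : ℝ≥0 → Ω → Vec dx) (t : ℝ≥0) :
    Measurable[dataHistory ξ W t] (W t) :=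
  (comap_measurable (W t)).mono
    ((le_iSup (fun s : Set.Iic t => MeasurableSpace.comap (W s) inferInstance)
      ⟨t, Set.mem_Iic.2 le_rfl⟩).trans le_sup_right) le_rfl

/-- A mean-field equation with continuous driver and square integrable data has an admissible
solution, driven by a continuous modification of the noise. -/
theorem IsWiener.exists_admissible [IsProbabilityMeasure P] (hW : IsWiener P 𝓕 W)
    (hξ : Measurable[𝓕 0] ξ) (hξ2 : MemLp ξ 2 P) {L : ℝ≥0} {B C : State dθ dx → State dθ dx}
    (hB : LipschitzWith L B) (hC : LipschitzWith L C) (γx : ℝ) (θ₀ m₀ : Vec dθ) :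
    ∃ V Z, IsDriver P (completedFiltration P _ (monotone_dataHistory ξ W))
        (noise γx θ₀ m₀ ξ V) ∧
      IsAdmissible P (completedFiltration P _ (monotone_dataHistory ξ W))
        (noise γx θ₀ m₀ ξ V) Z ∧
      (∀ t ω, Z t ω = meanFieldStep P B C (noise γx θ₀ m₀ ξ V) Z t ω) ∧
      ∀ᵐ ω ∂P, ∀ t, V t ω = W t ω := by
  have hle : ∀ t, dataHistory ξ W t ≤ mΩ := fun t => (hW.dataHistory_le hξ t).trans (𝓕.le t)
  set 𝓗 := completedFiltration P _ (monotone_dataHistory ξ W) with h𝓗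
  -- Paths of `W` are continuous only almost surely. The bad paths are enclosed in a measurable null
  -- set, on which the noise is replaced by zero.
  obtain ⟨G, hGsub, hGm, hG0⟩ := exists_measurable_superset_of_null (ae_iff.1 hW.cont)
  have hGae : ∀ᵐ ω ∂P, ω ∈ Gᶜ := compl_mem_ae_iff.2 hG0
  have hGcont : ∀ ω ∈ Gᶜ, Continuous fun t => W t ω := fun ω hω => by
    by_contra h
    exact hω (hGsub h)
  set V : ℝ≥0 → Ω → Vec dx := fun t => Gᶜ.indicator (W t) with hVdef
  have hVW : ∀ᵐ ω ∂P, ∀ t, V t ω = W t ω := by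
    filter_upwards [hGae] with ω hω t using Set.indicator_of_mem hω _
  have hVt : ∀ t, V t =ᵐ[P] W t := fun t => hVW.mono fun ω hω => hω t
  -- Being almost surely the whole space, `Gᶜ` belongs to the completed σ-algebra at every time,
  -- though perhaps not to `dataHistory`; hence the construction in the completion.
  have hGH : ∀ t, MeasurableSet[𝓗 t] Gᶜ := fun t =>
    measurableSet_completedFiltration.2
      ⟨⟨Set.univ, MeasurableSet.univ, Filter.eventuallyEq_univ.2 hGae⟩, hGm.compl⟩
  have hN : IsDriver P 𝓗 (noise γx θ₀ m₀ ξ V) := by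
    refine isDriver_noise γx θ₀ m₀ (fun t => ?_) hξ2 (fun t => ?_) (fun ω => ?_)
      (fun t => (hW.memLp t).ae_eq (hVt t).symm) fun T => ⟨dx * T, fun t ht => ?_⟩
    · exact ((measurable_dataHistory_init ξ W t).mono
        (le_completedFiltration P _ hle t) le_rfl).stronglyMeasurable
    · exact StronglyMeasurable.indicator ((measurable_dataHistory_noise ξ W t).mono
        (le_completedFiltration P _ hle t) le_rfl).stronglyMeasurable (hGH t)
    · by_cases hω : ω ∈ Gᶜ
      · simpa only [hVdef, Set.indicator_of_mem hω] using hGcont ω hω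
      · simpa only [hVdef, Set.indicator_of_notMem hω] using continuous_const
    · have : ∫ ω, ‖V t ω‖ ^ 2 ∂P = ∫ ω, ‖W t ω‖ ^ 2 ∂P :=
        integral_congr_ae ((hVt t).mono fun ω hω => by simp only [hω])
      rw [this, hW.integral_norm_sq]
      have : (t : ℝ) ≤ T := NNReal.coe_le_coe.2 ht
      gcongr
  obtain ⟨Z, hZ, hZeq⟩ := exists_eq_meanFieldStep hN hB hC
  exact ⟨V, Z, hN, hZ, hZeq, hVW⟩

/-- Existence of a strong solution with deterministic parameters and finite second moments. -/
theorem IsWiener.exists_isSolution [IsProbabilityMeasure P] {K : ℝ} (hℓ : HasLipschitzGradient ℓ K)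
    (hW : IsWiener P 𝓕 W) (hξ : Measurable[𝓕 0] ξ) (hξ2 : MemLp ξ 2 P)
    (ηθ γθ ηx γx : ℝ) (θ₀ m₀ : Vec dθ) (T : ℝ≥0∞) :
    ∃ (θ m : ℝ≥0 → Vec dθ) (X U : ℝ≥0 → Ω → Vec dx),
      IsSolution P ℓ ηθ γθ ηx γx θ₀ m₀ ξ W T (dataHistory ξ W)
        (fun t _ => θ t) (fun t _ => m t) X U ∧
      ∀ t, IsP2 (P.map fun ω => (X t ω, U t ω)) := by
  obtain ⟨L, hB, hC, hL⟩ := hℓ.exists_lipschitzWith_drift ηθ γθ ηx γx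
  obtain ⟨V, Z, hN, hZ, hZeq, hVW⟩ := hW.exists_admissible hξ hξ2 hB hC γx θ₀ m₀
  set c : ℝ≥0 → Vec dθ := fun t => ∫ ω, gradTheta ℓ (Z t ω).1 (Z t ω).2.2.1 ∂P with hcdef
  have hg : ∀ t, Integrable (fun ω => gradTheta ℓ (Z t ω).1 (Z t ω).2.2.1) P := fun t =>
    (ContinuousLinearMap.fst ℝ (Vec dθ) (Vec dx × Vec dx) ∘L
      ContinuousLinearMap.snd ℝ (Vec dθ) (Vec dθ × Vec dx × Vec dx)).integrable_comp
        (hZ.integrable_comp hN hC t)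
  have hmean : ∀ t, ∫ ω, meanDrift ℓ (Z t ω) ∂P = momentumInclusion dθ dx (c t) := fun t =>
    (momentumInclusion dθ dx).integral_comp_comm (hg t)
  have hcI : ∀ a b : ℝ, IntervalIntegrable (fun s : ℝ => c s.toNNReal) volume a b := by
    intro a b
    have h := hZ.intervalIntegrable_mean hN hC a b
    simp only [hmean] at h
    let p := ContinuousLinearMap.fst ℝ (Vec dθ) (Vec dx × Vec dx) ∘L
      ContinuousLinearMap.snd ℝ (Vec dθ) (Vec dθ × Vec dx × Vec dx)
    exact ⟨p.integrable_comp h.1, p.integrable_comp h.2⟩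
  have hcontOn : ∀ ω, ContinuousOn (fun t => Z t ω) (times ∞) := fun ω => (hZ.cont ω).continuousOn
  have htop : ∀ t : ℝ≥0, t ∈ times ∞ := fun t => (le_top : (t : ℝ≥0∞) ≤ ∞)
  have heq : ∀ ω (t : ℝ≥0),
      (Z t ω).1 = θ₀ + ∫ s in (0 : ℝ)..t, ηθ • (Z s.toNNReal ω).2.1 ∧
      (Z t ω).2.1 = m₀ + ∫ s in (0 : ℝ)..t,
        (c s.toNNReal - (γθ * ηθ) • (Z s.toNNReal ω).2.1) ∧
      (Z t ω).2.2.1 = (ξ ω).1 + ∫ s in (0 : ℝ)..t, ηx • (Z s.toNNReal ω).2.2.2 ∧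
      (Z t ω).2.2.2 = ((ξ ω).2 + √(2 * γx) • V t ω) + ∫ s in (0 : ℝ)..t,
        (gradX ℓ (Z s.toNNReal ω).1 (Z s.toNNReal ω).2.2.1
          - (γx * ηx) • (Z s.toNNReal ω).2.2.2) := by
    intro ω t
    have h := hZeq t ω
    simp only [meanFieldStep, hmean] at h
    exact (SolvesPath.eq_iff hB (z := fun t => Z t ω) (htop t) (hcontOn ω) (hcI _ _)).1 h
  -- Any sample point will do, since the equations for `Z` hold at every ω. All paths share the
  -- drift `c`, so `parameters_unique` applies with constant 0 and the parameters do not depend on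
  -- ω.
  obtain ⟨ω₀, -⟩ := hVW.exists
  have hdet : ∀ ω t, (Z t ω).1 = (Z t ω₀).1 ∧ (Z t ω).2.1 = (Z t ω₀).2.1 := by
    intro ω t
    have hp : ∀ ω, Continuous fun s : ℝ => Z s.toNNReal ω := fun ω =>
      (hZ.cont ω).comp continuous_real_toNNReal
    have h1 : ∀ ω, ∀ s ∈ Set.Icc (0 : ℝ) t, (Z s.toNNReal ω).1
        = θ₀ + ∫ r in (0 : ℝ)..s, ηθ • (Z r.toNNReal ω).2.1 := fun ω s hs => by
      have := (heq ω s.toNNReal).1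
      rwa [Real.coe_toNNReal _ hs.1] at this
    have h2 : ∀ ω, ∀ s ∈ Set.Icc (0 : ℝ) t, (Z s.toNNReal ω).2.1 = m₀ + ∫ r in (0 : ℝ)..s,
        (c r.toNNReal - (γθ * ηθ) • (Z r.toNNReal ω).2.1) := fun ω s hs => by
      have := (heq ω s.toNNReal).2.1
      rwa [Real.coe_toNNReal _ hs.1] at this
    have key := parameters_unique (L := 0) le_rfl t.coe_nonneg
      (hp ω).fst.continuousOn (hp ω).snd.fst.continuousOn
      (hp ω₀).fst.continuousOn (hp ω₀).snd.fst.continuousOn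
      (hcI 0 t) (hcI 0 t) (h1 ω) (h2 ω) (h1 ω₀) (h2 ω₀) (fun s _ => by simp)
    simpa only [Real.toNNReal_coe] using key
  have hmeas : ∀ t, StronglyMeasurable[completedFiltration P _ (monotone_dataHistory ξ W) t] (Z t) :=
    hZ.adapted
  have hXs := fun t => continuous_fst.comp_stronglyMeasurable
    (continuous_snd.comp_stronglyMeasurable (continuous_snd.comp_stronglyMeasurable (hmeas t)))
  have hUs := fun t => continuous_snd.comp_stronglyMeasurable
    (continuous_snd.comp_stronglyMeasurable (continuous_snd.comp_stronglyMeasurable (hmeas t)))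
  have hXm : ∀ t, AEMeasurable (fun ω => (Z t ω).2.2.1) P := fun t =>
    ((hXs t).mono inf_le_right).measurable.aemeasurable
  have hgc : ∀ θ : Vec dθ, Continuous fun x : Vec dx => gradTheta ℓ θ x := fun θ =>
    hL.continuous.comp (continuous_const.prodMk continuous_id)
  -- Once θ is deterministic, the expectation defining `c` becomes an integral against the law of
  -- X_t alone, the form of the drift in `IsSolution`.
  have hmap : ∀ t, ∫ x, gradTheta ℓ (Z t ω₀).1 x ∂(P.map fun ω => (Z t ω).2.2.1) = c t := by
    intro t
    refine (integral_map (hXm t) (hgc _).aestronglyMeasurable).trans ?_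
    simp only [hcdef, (hdet _ t).1]
  refine ⟨fun t => (Z t ω₀).1, fun t => (Z t ω₀).2.1, fun t ω => (Z t ω).2.2.1,
    fun t ω => (Z t ω).2.2.2, ?_, fun t => ?_⟩
  · constructor
    · exact fun t _ => aestronglyMeasurable_const
    · exact fun t _ => aestronglyMeasurable_const
    · exact fun t _ => aestronglyMeasurable_of_completedFiltration (hXs t)
    · exact fun t _ => aestronglyMeasurable_of_completedFiltration (hUs t)
    · exact Filter.Eventually.of_forall fun _ => (hZ.cont ω₀).fst.continuousOn
    · exact Filter.Eventually.of_forall fun _ => (hZ.cont ω₀).snd.fst.continuousOn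
    · exact Filter.Eventually.of_forall fun ω => (hZ.cont ω).snd.snd.fst.continuousOn
    · exact Filter.Eventually.of_forall fun ω => (hZ.cont ω).snd.snd.snd.continuousOn
    · refine Filter.Eventually.of_forall fun _ t _ => ?_
      refine (integrable_map_measure (hgc _).aestronglyMeasurable (hXm t)).2 ((hg t).congr ?_)
      exact Filter.Eventually.of_forall fun ω => by simp only [Function.comp_apply, (hdet ω t).1]
    · refine Filter.Eventually.of_forall fun _ t _ => ?_
      simpa only [hmap] using hcI 0 t
    · exact Filter.Eventually.of_forall fun _ t _ => (heq ω₀ t).1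
    · refine Filter.Eventually.of_forall fun _ t _ => ?_
      simpa only [hmap] using (heq ω₀ t).2.1
    · exact Filter.Eventually.of_forall fun ω t _ => (heq ω t).2.2.1
    · filter_upwards [hVW] with ω hω t _
      have h := (heq ω t).2.2.2
      rw [hω t, add_right_comm] at h
      simpa only [(hdet ω _).1] using h
  · have h2 := hZ.memLp hN t
    refine isP2_map_prodMk ?_ ?_
    · exact h2.norm.mono' ((hXs t).mono inf_le_right).aestronglyMeasurable
        (Filter.Eventually.of_forall fun ω =>
          (norm_fst_le _).trans ((norm_snd_le _).trans (norm_snd_le _)))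
    · exact h2.norm.mono' ((hUs t).mono inf_le_right).aestronglyMeasurable
        (Filter.Eventually.of_forall fun ω =>
          (norm_snd_le _).trans ((norm_snd_le _).trans (norm_snd_le _)))

end Existence

end MomentumFlow

/-! ### Well-posedness of the McKean–Vlasov system -/

theorem proposition1 {dθ dx : ℕ} (ℓ : MomentumFlow.Vec dθ → MomentumFlow.Vec dx → ℝ)
    (K : ℝ) (hK : 0 < K) (hℓ : MomentumFlow.HasLipschitzGradient ℓ K)
    (ηθ γθ ηx γx : ℝ) (hηθ : 0 < ηθ) (hγθ : 0 ≤ γθ) (hηx : 0 < ηx) (hγx : 0 ≤ γx)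
    -- the initial condition
    (θ₀ m₀ : MomentumFlow.Vec dθ)
    (q₀ : Measure (MomentumFlow.Vec dx × MomentumFlow.Vec dx)) (hq₀ : MomentumFlow.IsP2 q₀)
    -- the filtered probability space, the driving noise, and the initial value with law `q₀`
    {Ω : Type*} {mΩ : MeasurableSpace Ω} (P : Measure Ω) [IsProbabilityMeasure P]
    (𝓕 : Filtration ℝ≥0 mΩ) (W : ℝ≥0 → Ω → MomentumFlow.Vec dx)
    (hW : MomentumFlow.IsWiener P 𝓕 W)
    (ξ : Ω → MomentumFlow.Vec dx × MomentumFlow.Vec dx)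
    (hξ : Measurable[𝓕 0] ξ) (hξ_law : P.map ξ = q₀)
    -- the time horizon; `T = ∞` is the half-line
    (T : ℝ≥0∞) :
    ∃ (θ m : ℝ≥0 → MomentumFlow.Vec dθ) (X U : ℝ≥0 → Ω → MomentumFlow.Vec dx),
      -- existence: a strong solution, adapted to the completed history of `(ξ, W)`
      MomentumFlow.IsSolution P ℓ ηθ γθ ηx γx θ₀ m₀ ξ W T (MomentumFlow.dataHistory ξ W)
          (fun t _ => θ t) (fun t _ => m t) X U ∧
      -- its laws have finite second moments
      (∀ t ∈ MomentumFlow.times T, MomentumFlow.IsP2 (P.map fun ω => (X t ω, U t ω))) ∧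
      -- uniqueness: every solution adapted to `𝓕` is indistinguishable from it
      ∀ (θ' m' : ℝ≥0 → Ω → MomentumFlow.Vec dθ) (X' U' : ℝ≥0 → Ω → MomentumFlow.Vec dx),
        MomentumFlow.IsSolution P ℓ ηθ γθ ηx γx θ₀ m₀ ξ W T (fun t => 𝓕 t) θ' m' X' U' →
        ∀ᵐ ω ∂P, ∀ t ∈ MomentumFlow.times T,
          θ' t ω = θ t ∧ m' t ω = m t ∧ X' t ω = X t ω ∧ U' t ω = U t ω := by
  have hξm : Measurable ξ := hξ.mono (𝓕.le 0) le_rfl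
  obtain ⟨θ, m, X, U, hsol, hP2⟩ := hW.exists_isSolution hℓ hξ
    (hq₀.memLp_of_map_eq hξm hξ_law) ηθ γθ ηx γx θ₀ m₀ T
  exact ⟨θ, m, X, U, hsol, fun t _ => hP2 t, fun θ' m' X' U' hsol' =>
    hsol'.indistinguishable hℓ 𝓕.le (fun t => (hW.dataHistory_le hξ t).trans (𝓕.le t)) hsol⟩
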